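/- Let $\Sigma$ be a finite alphabet and $R$ a nonempty set of weights. An $R$-weighted automaton is $\mathcal A=(Q,\Sigma,\Delta,\mathrm{wgt})$ with $Q$ finite, $\Delta\subseteq Q\times\Sigma\times Q$ and $\mathrm{wgt}\colon\Delta\to R$. For $p,q\in Q$, let $L(\mathcal A_{p,q})\subseteq\Sigma^*$ be the set of labels of runs from $p$ to $q$ (with $\varepsilon$ included iff $p=q$), and for $u\in\Sigma^+$ let $[\![\mathcal A_{p,q}]\!](u)$ be the finite multiset of the weight sequences $\mathrm{wgt}(\delta_1)\cdots\mathrm{wgt}(\delta_n)\in R^+$ of all runs $\delta_1\cdots\delta_n$ from $p$ to $q$ with label $u$. The automaton is *aperiodic* if there is $m\ge 1$ such that $u^m\in L(\mathcal A_{r,s})\iff u^{m+1}\in L(\mathcal A_{r,s})$ for all $r,s\in Q$ and $u\in\Sigma^+$; it is *unambiguous from $p$ to $q$* if every $u\in\Sigma^+$ labels at most one run from $p$ to $q$. Formulas are given by $$\varphi::=\top\mid P_a(x)\mid x\le y\mid\neg\varphi\mid\varphi\wedge\varphi\mid\forall x\,\varphi\quad(\mathrm{FO}),\qquad \Psi::=r\mid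 \varphi\,?\,\Psi:\Psi\quad(\text{step-wFO}),$$ $$\Phi::=\mathbf 0\mid \textstyle\prod_x\Psi\mid \varphi\,?\,\Phi:\Phi\mid\Phi+\Phi\mid\sum_x\Phi\quad(\mathrm{wFO}),$$ with $a\in\Sigma$, $r\in R$; here $\varphi\,?\,X:Y$ means "if $\varphi$ then $X$ else $Y$". On a word $u\in\Sigma^+$ with a valuation $\sigma$ of the variables by positions $1,\dots,|u|$, FO formulas have their usual meaning ($P_a(x)$ says that the letter at $x$ is $a$), a step-wFO formula has a single weight as its value (that of the branch selected by the conditions), and the abstract semantics $[\![\Phi]\!](u,\sigma)$ of a wFO formula is the multiset of weight sequences with $[\![\mathbf 0]\!]=\emptyset$; $[\![\prod_x\Psi]\!](u,\sigma)=\{\!\{r_1\cdots r_{|u|}\}\!\}$ where $r_i$ is the value of $\Psi$ at $(u,\sigma[x\mapsto i])$; if-then-else selects a branch; $+$ is multiset union; and $[\![\sum_x\Phi]\!](u,\sigma)=\biguplus_i[\![\Phi]\!](u,\sigma[x\mapsto i])$. For sentences $\sigma$ is irrelevant and is omitted. **Theorem.** Let $\mathcal A=(Q,\Sigma,\Delta,\mathrm{wgt})$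 be an aperiodic $R$-weighted automaton that is unambiguous from $p$ to $q$, where $p,q\in Q$. Then one can construct a wFO sentence $$\Phi_{p,q}=\text{if }\varphi_{p,q}\text{ then }\textstyle\prod_x\Psi_{p,q}\text{ else }\mathbf 0,$$ where $\varphi_{p,q}$ is an FO sentence and $\Psi_{p,q}(x)$ is a step-wFO formula whose only free variable is $x$, such that $[\![\mathcal A_{p,q}]\!](u)=[\![\Phi_{p,q}]\!](u)$ for all $u\in\Sigma^+$. "One can construct" means that such a sentence exists for every $R$ and, if the elements of $R$ are effectively presented (by a primitive recursive coding), that one algorithm computes it: there is a partial recursive function which, given $|Q|$, $|\Sigma|$, a list of the weighted transitions, and $p,q$ (states and letters being numbered), halts whenever $\mathcal A$ is aperiodic and unambiguous from $p$ to $q$ and then outputs such a sentence. -/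

import Mathlib

universe u v w

namespace WFOLogic

/-! ### Weighted automata -/

/-- An `R`-weighted automaton with states `Q` over the alphabet `α`: a set of transitions
`(source, letter, target)` and a weight for every transition. -/
structure WeightedAutomaton (Q : Type u) (α : Type v) (R : Type w) where
  trans : Set (Q × α × Q)
  wgt : trans → R

namespace WeightedAutomaton

variable {Q : Type u} {α : Type v} {R : Type w} (A : WeightedAutomaton Q α R)

def src (δ : A.trans) : Q := δ.1.1

def letter (δ : A.trans) : α := δ.1.2.1

def tgt (δ : A.trans) : Q := δ.1.2.2

/-- `A.IsRun p ρ q`: the sequence of transitions `ρ` is a run of `A` from `p` to `q`.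
The empty sequence is a run from `p` to `q` exactly when `p = q`. -/
def IsRun : Q → List A.trans → Q → Prop
  | p, [], q => p = q
  | p, δ :: ρ, q => A.src δ = p ∧ IsRun (A.tgt δ) ρ q

/-- The set of runs from `p` to `q` with label `u`. -/
def runs (p q : Q) (u : List α) : Set (List A.trans) :=
  {ρ | A.IsRun p ρ q ∧ ρ.map A.letter = u}

/-- The set of labels of runs from `p` to `q` (with the empty word if `p = q`). -/
def lang (p q : Q) : Set (List α) :=
  {u | (A.runs p q u).Nonempty}

/-- There is `m ≥ 1` such that, for all states `p`, `q` and all nonempty words `u`,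
the word `u ^ m` labels a run from `p` to `q` iff `u ^ (m + 1)` does. -/
def Aperiodic : Prop :=
  ∃ m : ℕ, 1 ≤ m ∧ ∀ (p q : Q) (u : List α), u ≠ [] →
    ((List.replicate m u).flatten ∈ A.lang p q ↔
      (List.replicate (m + 1) u).flatten ∈ A.lang p q)

/-- Every nonempty word labels at most one run from `p` to `q`. -/
def UnambiguousFromTo (p q : Q) : Prop :=
  ∀ u : List α, u ≠ [] → (A.runs p q u).Subsingleton

theorem finite_runs [Finite Q] [Finite α] (p q : Q) (u : List α) : (A.runs p q u).Finite := by
  refine (List.finite_length_eq A.trans u.length).subset ?_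
  rintro ρ ⟨-, h⟩
  simpa using congrArg List.length h

/-- The abstract semantics from `p` to `q`: the multiset of the weight sequences of all runs
from `p` to `q` with label `u` (one occurrence for every run). -/
noncomputable def absSem [Finite Q] [Finite α] (p q : Q) (u : List α) : Multiset (List R) :=
  (A.finite_runs p q u).toFinset.val.map (fun ρ => ρ.map A.wgt)

/-- The finite list `T` is a listing of all weighted transitions `(source, letter, target, weight)`
of an automaton whose states and letters are `0, …, n - 1` and `0, …, k - 1`. -/
def ListedBy {n k : ℕ} (A : WeightedAutomaton (Fin n) (Fin k) R)
    (T : List (ℕ × ℕ × ℕ × R)) : Prop :=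
  ∀ (s a t : ℕ) (r : R), (s, a, t, r) ∈ T ↔
    ∃ δ : A.trans, (A.src δ : ℕ) = s ∧ (A.letter δ : ℕ) = a ∧ (A.tgt δ : ℕ) = t ∧ A.wgt δ = r

end WeightedAutomaton

/-! ### Syntax of the logics; the first-order variables are the natural numbers -/

/-- Formulas of first-order logic over words with letters in `α`. -/
inductive FO (α : Type v) : Type v
  | top : FO α
  | letter (a : α) (x : ℕ) : FO α
  | le (x y : ℕ) : FO α
  | neg (φ : FO α) : FO α
  | and (φ ψ : FO α) : FO α
  | all (x : ℕ) (φ : FO α) : FO α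

/-- Step formulas: constants and if-then-else with first-order conditions. -/
inductive StepWFO (α : Type v) (R : Type w) : Type (max v w)
  | const (r : R) : StepWFO α R
  | ite (φ : FO α) (Ψ₁ Ψ₂ : StepWFO α R) : StepWFO α R

/-- Formulas of weighted first-order logic. -/
inductive WFO (α : Type v) (R : Type w) : Type (max v w)
  | zero : WFO α R
  | prod (x : ℕ) (Ψ : StepWFO α R) : WFO α R
  | ite (φ : FO α) (Φ₁ Φ₂ : WFO α R) : WFO α R
  | add (Φ₁ Φ₂ : WFO α R) : WFO α R
  | sum (x : ℕ) (Φ : WFO α R) : WFO α R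

/-! ### Free variables -/

variable {α : Type v} {R : Type w}

def FO.freeVars : FO α → Finset ℕ
  | .top => ∅
  | .letter _ x => {x}
  | .le x y => {x, y}
  | .neg φ => φ.freeVars
  | .and φ ψ => φ.freeVars ∪ ψ.freeVars
  | .all x φ => φ.freeVars.erase x

def StepWFO.freeVars : StepWFO α R → Finset ℕ
  | .const _ => ∅
  | .ite φ Ψ₁ Ψ₂ => φ.freeVars ∪ Ψ₁.freeVars ∪ Ψ₂.freeVars

def WFO.freeVars : WFO α R → Finset ℕ
  | .zero => ∅
  | .prod x Ψ => Ψ.freeVars.erase x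
  | .ite φ Φ₁ Φ₂ => φ.freeVars ∪ Φ₁.freeVars ∪ Φ₂.freeVars
  | .add Φ₁ Φ₂ => Φ₁.freeVars ∪ Φ₂.freeVars
  | .sum x Φ => Φ.freeVars.erase x

/-! ### Semantics on a word `u` under a valuation `σ` of the variables by positions of `u`

A valuation exists only if `u` is nonempty. -/

/-- Satisfaction `u, σ ⊨ φ`. -/
def FO.Sat (u : List α) : FO α → (ℕ → Fin u.length) → Prop
  | .top, _ => True
  | .letter a x, σ => u.get (σ x) = a
  | .le x y, σ => σ x ≤ σ y
  | .neg φ, σ => ¬ φ.Sat u σ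
  | .and φ ψ, σ => φ.Sat u σ ∧ ψ.Sat u σ
  | .all x φ, σ => ∀ i : Fin u.length, φ.Sat u (Function.update σ x i)

open Classical in
/-- The value of a step formula, which is a single weight. -/
noncomputable def StepWFO.sem (u : List α) : StepWFO α R → (ℕ → Fin u.length) → R
  | .const r, _ => r
  | .ite φ Ψ₁ Ψ₂, σ => if φ.Sat u σ then Ψ₁.sem u σ else Ψ₂.sem u σ

open Classical in
/-- The abstract semantics of a weighted formula: a finite multiset of weight sequences. -/
noncomputable def WFO.absSem (u : List α) : WFO α R → (ℕ → Fin u.length) → Multiset (List R)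
  | .zero, _ => 0
  | .prod x Ψ, σ => {List.ofFn fun i : Fin u.length => Ψ.sem u (Function.update σ x i)}
  | .ite φ Φ₁ Φ₂, σ => if φ.Sat u σ then Φ₁.absSem u σ else Φ₂.absSem u σ
  | .add Φ₁ Φ₂, σ => Φ₁.absSem u σ + Φ₂.absSem u σ
  | .sum x Φ, σ => ∑ i : Fin u.length, Φ.absSem u (Function.update σ x i)

/-! ### Gödel numbers of formulas -/

def FO.code [Encodable α] : FO α → ℕ
  | .top => Nat.pair 0 0
  | .letter a x => Nat.pair 1 (Nat.pair (Encodable.encode a) x)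
  | .le x y => Nat.pair 2 (Nat.pair x y)
  | .neg φ => Nat.pair 3 φ.code
  | .and φ ψ => Nat.pair 4 (Nat.pair φ.code ψ.code)
  | .all x φ => Nat.pair 5 (Nat.pair x φ.code)

def StepWFO.code [Encodable α] [Encodable R] : StepWFO α R → ℕ
  | .const r => Nat.pair 0 (Encodable.encode r)
  | .ite φ Ψ₁ Ψ₂ => Nat.pair 1 (Nat.pair φ.code (Nat.pair Ψ₁.code Ψ₂.code))

def WFO.code [Encodable α] [Encodable R] : WFO α R → ℕ
  | .zero => Nat.pair 0 0
  | .prod x Ψ => Nat.pair 1 (Nat.pair x Ψ.code)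
  | .ite φ Φ₁ Φ₂ => Nat.pair 2 (Nat.pair φ.code (Nat.pair Φ₁.code Φ₂.code))
  | .add Φ₁ Φ₂ => Nat.pair 3 (Nat.pair Φ₁.code Φ₂.code)
  | .sum x Φ => Nat.pair 4 (Nat.pair x Φ.code)

theorem FO.code_injective [Encodable α] : Function.Injective (FO.code (α := α)) := by
  intro φ
  induction φ with
  | neg φ ih => intro ψ h; cases ψ <;> simp [FO.code] at h ⊢; exact ih h
  | and φ₁ φ₂ ih₁ ih₂ =>
    intro ψ h; cases ψ <;> simp [FO.code] at h ⊢; exact ⟨ih₁ h.1, ih₂ h.2⟩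
  | all x φ ih => intro ψ h; cases ψ <;> simp [FO.code] at h ⊢; exact ⟨h.1, ih h.2⟩
  | _ => intro ψ h; cases ψ <;> simp [FO.code] at h ⊢ <;> exact h

theorem StepWFO.code_injective [Encodable α] [Encodable R] :
    Function.Injective (StepWFO.code (α := α) (R := R)) := by
  intro Ψ
  induction Ψ with
  | const r => intro Ψ' h; cases Ψ' <;> simp [StepWFO.code] at h ⊢; exact h
  | ite φ Ψ₁ Ψ₂ ih₁ ih₂ =>
    intro Ψ' h; cases Ψ' <;> simp [StepWFO.code] at h ⊢
    exact ⟨FO.code_injective h.1, ih₁ h.2.1, ih₂ h.2.2⟩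

theorem WFO.code_injective [Encodable α] [Encodable R] :
    Function.Injective (WFO.code (α := α) (R := R)) := by
  intro Φ
  induction Φ with
  | zero => intro Φ' h; cases Φ' <;> simp [WFO.code] at h ⊢
  | prod x Ψ =>
    intro Φ' h; cases Φ' <;> simp [WFO.code] at h ⊢
    exact ⟨h.1, StepWFO.code_injective h.2⟩
  | ite φ Φ₁ Φ₂ ih₁ ih₂ =>
    intro Φ' h; cases Φ' <;> simp [WFO.code] at h ⊢
    exact ⟨FO.code_injective h.1, ih₁ h.2.1, ih₂ h.2.2⟩
  | add Φ₁ Φ₂ ih₁ ih₂ =>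
    intro Φ' h; cases Φ' <;> simp [WFO.code] at h ⊢; exact ⟨ih₁ h.1, ih₂ h.2⟩
  | sum x Φ ih => intro Φ' h; cases Φ' <;> simp [WFO.code] at h ⊢; exact ⟨h.1, ih h.2⟩

end WFOLogic

namespace WFOLogic

/-! ### Back-and-forth equivalence of words

A word is given by a list of positions and a labelling of the positions. Removing positions or
relabelling therefore never renumbers positions. -/

/-! Reading a word acts on sets of states by sending a set to the set of states reachable from it.
Aperiodicity of the automaton makes these maps a monoid in which every element `h` satisfies `h^[m +
1] = h^[m]` for some `m`. The core of the proof is that such an action is invariant under the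
Ehrenfeucht–Fraïssé game: words equivalent for `k` rounds, with `k` depending only on the number of
states, act identically (`PosWord.EF.eval_eq`). The induction is on the size of the set `Y` acted
upon and then on the number of letters. A letter `c` that moves a point of `Y` cannot permute `Y`,
so `c(Y)` is smaller. Cutting a word at the occurrences of `c` leaves blocks without `c`, and each
block followed by `c` becomes a single letter acting on `c(Y)`. The blocks are definable with one
quantifier, so both kinds of simpler words inherit the equivalence.

This is applied on both sides of a marked position. If a run from `p` to `q` on `w` takes the
transition `δ` at position `i`, and `(w, i)` is equivalent to `(v, j)`, then the prefixes have the
same reachability, and so do the suffixes; hence `v` labels a run from `p` to `q` that takes the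
same `δ` at `j` (`WeightedAutomaton.exists_run_of_EF`). Every marked word is equivalent to one of
bounded length (`PosWord.exists_short_word`), so finitely many marked runs suffice, each described
by a Hintikka formula. The condition says that every position matches one of them, and the step
formula returns the weight attached to the first match. By unambiguity all matches at a position
come from the one run of the word, so this weight is the right one.

The bounds on rounds and lengths are primitive recursive in the numbers of states and letters, and
the aperiodicity index never enters them. Hence the list of short marked runs, and from it the code
of the sentence, is computed directly. -/

structure PosWord (A : Type u) where
  dom : List ℕ
  lab : ℕ → A

namespace PosWord

variable {A : Type u} {B : Type v}

/-- The pairs of positions in `p` form a partial isomorphism. -/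
def Compat (u v : PosWord A) (p : List (ℕ × ℕ)) : Prop :=
  (∀ x ∈ p, u.lab x.1 = v.lab x.2) ∧ ∀ x ∈ p, ∀ y ∈ p, (x.1 ≤ y.1 ↔ x.2 ≤ y.2)

/-- Duplicator wins the `k`-round Ehrenfeucht–Fraïssé game from the pebble position `p`. -/
def EF (u v : PosWord A) : ℕ → List (ℕ × ℕ) → Prop
  | 0, p => Compat u v p
  | k + 1, p => Compat u v p ∧ (∀ i ∈ u.dom, ∃ j ∈ v.dom, EF u v k ((i, j) :: p)) ∧
      ∀ j ∈ v.dom, ∃ i ∈ u.dom, EF u v k ((i, j) :: p)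

theorem Compat.subset {u v : PosWord A} {p q : List (ℕ × ℕ)} (h : Compat u v p) (hq : q ⊆ p) :
    Compat u v q :=
  ⟨fun x hx => h.1 x (hq hx), fun x hx y hy => h.2 x (hq hx) y (hq hy)⟩

theorem EF.compat {u v : PosWord A} {k : ℕ} {p : List (ℕ × ℕ)} (h : EF u v k p) :
    Compat u v p := by
  cases k with
  | zero => exact h
  | succ k => exact h.1

theorem EF.subset {u v : PosWord A} {k : ℕ} {p q : List (ℕ × ℕ)} (h : EF u v k p)
    (hq : q ⊆ p) : EF u v k q := by
  induction k generalizing p q with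
  | zero => exact Compat.subset h hq
  | succ k ih =>
    refine ⟨h.1.subset hq, fun i hi => ?_, fun j hj => ?_⟩
    · obtain ⟨j, hj, H⟩ := h.2.1 i hi
      exact ⟨j, hj, ih H (List.cons_subset_cons _ hq)⟩
    · obtain ⟨i, hi, H⟩ := h.2.2 j hj
      exact ⟨i, hi, ih H (List.cons_subset_cons _ hq)⟩

theorem EF.pred {u v : PosWord A} {k : ℕ} {p : List (ℕ × ℕ)} (h : EF u v (k + 1) p) :
    EF u v k p := by
  induction k generalizing p with
  | zero => exact h.1
  | succ k ih =>
    refine ⟨h.1, fun i hi => ?_, fun j hj => ?_⟩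
    · obtain ⟨j, hj, H⟩ := h.2.1 i hi
      exact ⟨j, hj, ih H⟩
    · obtain ⟨i, hi, H⟩ := h.2.2 j hj
      exact ⟨i, hi, ih H⟩

theorem EF.mono {u v : PosWord A} {k l : ℕ} {p : List (ℕ × ℕ)} (h : EF u v k p)
    (hl : l ≤ k) : EF u v l p := by
  induction hl with
  | refl => exact h
  | step _ ih => exact ih h.pred

theorem EF.symm {u v : PosWord A} {k : ℕ} {p : List (ℕ × ℕ)} (h : EF u v k p) :
    EF v u k (p.map Prod.swap) := by
  have hc : ∀ {p : List (ℕ × ℕ)}, Compat u v p → Compat v u (p.map Prod.swap) := by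
    intro p h
    simp only [Compat, List.mem_map, forall_exists_index, and_imp, forall_apply_eq_imp_iff₂]
    exact ⟨fun x hx => (h.1 x hx).symm, fun x hx y hy => (h.2 x hx y hy).symm⟩
  induction k generalizing p with
  | zero => exact hc h
  | succ k ih =>
    refine ⟨hc h.1, fun i hi => ?_, fun j hj => ?_⟩
    · obtain ⟨j, hj, H⟩ := h.2.2 i hi
      exact ⟨j, hj, ih H⟩
    · obtain ⟨i, hi, H⟩ := h.2.1 j hj
      exact ⟨i, hi, ih H⟩

/-- Both games are played at once: Duplicator's reply in the middle word serves as Spoiler's move in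
the other game. Triples keep the three pebbles of a round together. -/
theorem EF.trans {u v w : PosWord A} {k : ℕ} {l : List (ℕ × ℕ × ℕ)}
    (h₁ : EF u v k (l.map fun x => (x.1, x.2.1))) (h₂ : EF v w k (l.map fun x => x.2)) :
    EF u w k (l.map fun x => (x.1, x.2.2)) := by
  have hc : ∀ {l : List (ℕ × ℕ × ℕ)}, Compat u v (l.map fun x => (x.1, x.2.1)) →
      Compat v w (l.map fun x => x.2) → Compat u w (l.map fun x => (x.1, x.2.2)) := by
    intro l h₁ h₂
    simp only [Compat, List.mem_map, forall_exists_index, and_imp, forall_apply_eq_imp_iff₂]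
      at h₁ h₂ ⊢
    exact ⟨fun x hx => (h₁.1 x hx).trans (h₂.1 x hx),
      fun x hx y hy => (h₁.2 x hx y hy).trans (h₂.2 x hx y hy)⟩
  induction k generalizing l with
  | zero => exact hc h₁ h₂
  | succ k ih =>
    refine ⟨hc h₁.1 h₂.1, fun i hi => ?_, fun m hm => ?_⟩
    · obtain ⟨j, hj, H₁⟩ := h₁.2.1 i hi
      obtain ⟨m, hm, H₂⟩ := h₂.2.1 j hj
      exact ⟨m, hm, ih (l := (i, j, m) :: l) H₁ H₂⟩
    · obtain ⟨j, hj, H₂⟩ := h₂.2.2 m hm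
      obtain ⟨i, hi, H₁⟩ := h₁.2.2 j hj
      exact ⟨i, hi, ih (l := (i, j, m) :: l) H₁ H₂⟩

/-- Passing to definable subdomains and definable labellings. -/
theorem EF.definable {u v : PosWord A} {u' v' : PosWord B} (hu : u'.dom ⊆ u.dom)
    (hv : v'.dom ⊆ v.dom) {p₀ : List (ℕ × ℕ)} {r : ℕ}
    (h : ∀ i ∈ u.dom, ∀ j ∈ v.dom, EF u v r ((i, j) :: p₀) →
      (i ∈ u'.dom ↔ j ∈ v'.dom) ∧ (i ∈ u'.dom → j ∈ v'.dom → u'.lab i = v'.lab j))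
    {k : ℕ} {p : List (ℕ × ℕ)} (hp : ∀ x ∈ p, x.1 ∈ u'.dom ∧ x.2 ∈ v'.dom)
    (H : EF u v (k + r) (p ++ p₀)) : EF u' v' k p := by
  have hc : ∀ {k : ℕ} {p : List (ℕ × ℕ)}, (∀ x ∈ p, x.1 ∈ u'.dom ∧ x.2 ∈ v'.dom) →
      EF u v (k + r) (p ++ p₀) → Compat u' v' p := by
    intro k p hp H
    refine ⟨fun x hx => ?_, (H.compat.subset (List.subset_append_left _ _)).2⟩
    obtain ⟨h₁, h₂⟩ := hp x hx
    refine (h x.1 (hu h₁) x.2 (hv h₂) ((H.mono (by omega)).subset ?_)).2 h₁ h₂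
    exact List.cons_subset.2 ⟨List.mem_append_left _ hx, List.subset_append_right _ _⟩
  induction k generalizing p with
  | zero => exact hc hp H
  | succ k ih =>
    -- At least `r` rounds are held in reserve after every move; they decide membership in the
    -- subdomain, so replies never leave it.
    have key : ∀ i ∈ u.dom, ∀ j ∈ v.dom, EF u v (k + r) ((i, j) :: (p ++ p₀)) →
        (i ∈ u'.dom ↔ j ∈ v'.dom) := fun i hi j hj H =>
      (h i hi j hj ((H.mono (by omega)).subset
        (List.cons_subset_cons _ (List.subset_append_right _ _)))).1
    have H' := H
    rw [Nat.add_right_comm] at H'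
    refine ⟨hc hp H, fun i hi => ?_, fun j hj => ?_⟩
    · obtain ⟨j, hj, G⟩ := H'.2.1 i (hu hi)
      have hj' := (key i (hu hi) j hj G).1 hi
      exact ⟨j, hj', ih (List.forall_mem_cons.2 ⟨⟨hi, hj'⟩, hp⟩) G⟩
    · obtain ⟨i, hi, G⟩ := H'.2.2 j (hv hj)
      have hi' := (key i hi j (hv hj) G).2 hj
      exact ⟨i, hi', ih (List.forall_mem_cons.2 ⟨⟨hi', hj⟩, hp⟩) G⟩

/-- Order isomorphic words are equivalent. -/
theorem EF.of_map {u v : PosWord A} {e : List (ℕ × ℕ)} (he : Compat u v e)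
    (hu : e.map Prod.fst = u.dom) (hv : e.map Prod.snd = v.dom) (k : ℕ) {p : List (ℕ × ℕ)}
    (hp : p ⊆ e) : EF u v k p := by
  induction k generalizing p with
  | zero => exact he.subset hp
  | succ k ih =>
    refine ⟨he.subset hp, fun i hi => ?_, fun j hj => ?_⟩
    · rw [← hu] at hi
      obtain ⟨x, hx, rfl⟩ := List.mem_map.1 hi
      exact ⟨x.2, hv ▸ List.mem_map_of_mem hx, ih (List.cons_subset.2 ⟨hx, hp⟩)⟩
    · rw [← hv] at hj
      obtain ⟨x, hx, rfl⟩ := List.mem_map.1 hj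
      exact ⟨x.1, hu ▸ List.mem_map_of_mem hx, ih (List.cons_subset.2 ⟨hx, hp⟩)⟩

theorem EF.refl (u : PosWord A) (k : ℕ) {p : List (ℕ × ℕ)}
    (hp : ∀ x ∈ p, x.1 = x.2 ∧ x.1 ∈ u.dom) : EF u u k p := by
  refine EF.of_map (e := u.dom.map fun i => (i, i)) ⟨?_, ?_⟩ (by simp [Function.comp_def])
    (by simp [Function.comp_def]) k fun x hx => ?_
  · simp
  · simp
  · obtain ⟨i, j⟩ := x
    obtain ⟨h, h'⟩ := hp _ hx
    simp only at h h'
    subst h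
    exact List.mem_map.2 ⟨i, h', rfl⟩

/-- Equivalence is a congruence for concatenation. -/
theorem EF.append {lu lv : ℕ → A} {D₁ D₂ E₁ E₂ : List ℕ}
    (hD : ∀ i ∈ D₁, ∀ j ∈ D₂, i < j) (hE : ∀ i ∈ E₁, ∀ j ∈ E₂, i < j)
    {k : ℕ} {p₁ p₂ p : List (ℕ × ℕ)}
    (hp₁ : ∀ x ∈ p₁, x.1 ∈ D₁ ∧ x.2 ∈ E₁) (hp₂ : ∀ x ∈ p₂, x.1 ∈ D₂ ∧ x.2 ∈ E₂)
    (h₁ : EF ⟨D₁, lu⟩ ⟨E₁, lv⟩ k p₁) (h₂ : EF ⟨D₂, lu⟩ ⟨E₂, lv⟩ k p₂)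
    (hp : p ⊆ p₁ ++ p₂) : EF ⟨D₁ ++ D₂, lu⟩ ⟨E₁ ++ E₂, lv⟩ k p := by
  have hc : ∀ {p₁ p₂ p : List (ℕ × ℕ)}, (∀ x ∈ p₁, x.1 ∈ D₁ ∧ x.2 ∈ E₁) →
      (∀ x ∈ p₂, x.1 ∈ D₂ ∧ x.2 ∈ E₂) → Compat ⟨D₁, lu⟩ ⟨E₁, lv⟩ p₁ →
      Compat ⟨D₂, lu⟩ ⟨E₂, lv⟩ p₂ → p ⊆ p₁ ++ p₂ →
      Compat ⟨D₁ ++ D₂, lu⟩ ⟨E₁ ++ E₂, lv⟩ p := by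
    intro p₁ p₂ p hp₁ hp₂ h₁ h₂ hp
    refine ⟨fun x hx => ?_, fun x hx y hy => ?_⟩
    · rcases List.mem_append.1 (hp hx) with hx | hx
      · exact h₁.1 x hx
      · exact h₂.1 x hx
    · rcases List.mem_append.1 (hp hx) with hx | hx <;>
        rcases List.mem_append.1 (hp hy) with hy | hy
      · exact h₁.2 x hx y hy
      · have := hD _ (hp₁ x hx).1 _ (hp₂ y hy).1
        have := hE _ (hp₁ x hx).2 _ (hp₂ y hy).2
        omega
      · have := hD _ (hp₁ y hy).1 _ (hp₂ x hx).1
        have := hE _ (hp₁ y hy).2 _ (hp₂ x hx).2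
        omega
      · exact h₂.2 x hx y hy
  induction k generalizing p₁ p₂ p with
  | zero => exact hc hp₁ hp₂ h₁ h₂ hp
  | succ k ih =>
    refine ⟨hc hp₁ hp₂ h₁.1 h₂.1 hp, fun i hi => ?_, fun j hj => ?_⟩
    · rcases List.mem_append.1 hi with hi | hi
      -- Duplicator answers in the factor where Spoiler moved; the other factor merely gives up a
      -- round.
      · obtain ⟨j, hj, H⟩ := h₁.2.1 i hi
        exact ⟨j, List.mem_append_left _ hj, ih (List.forall_mem_cons.2 ⟨⟨hi, hj⟩, hp₁⟩) hp₂ H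
          h₂.pred (List.cons_subset_cons _ hp)⟩
      · obtain ⟨j, hj, H⟩ := h₂.2.1 i hi
        refine ⟨j, List.mem_append_right _ hj, ih hp₁ (List.forall_mem_cons.2 ⟨⟨hi, hj⟩, hp₂⟩)
          h₁.pred H (List.cons_subset.2 ⟨by simp, fun x hx => ?_⟩)⟩
        have := hp hx
        simp only [List.mem_append, List.mem_cons] at this ⊢
        tauto
    · rcases List.mem_append.1 hj with hj | hj
      · obtain ⟨i, hi, H⟩ := h₁.2.2 j hj
        exact ⟨i, List.mem_append_left _ hi, ih (List.forall_mem_cons.2 ⟨⟨hi, hj⟩, hp₁⟩) hp₂ H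
          h₂.pred (List.cons_subset_cons _ hp)⟩
      · obtain ⟨i, hi, H⟩ := h₂.2.2 j hj
        refine ⟨i, List.mem_append_right _ hi, ih hp₁ (List.forall_mem_cons.2 ⟨⟨hi, hj⟩, hp₂⟩)
          h₁.pred H (List.cons_subset.2 ⟨by simp, fun x hx => ?_⟩)⟩
        have := hp hx
        simp only [List.mem_append, List.mem_cons] at this ⊢
        tauto

/-! ### The number of equivalence classes -/

/-- A bound for the number of classes of words over `a` labels with `j` pebbles, up to
`k`-round equivalence. -/
def numClasses (a k j : ℕ) : ℕ :=
  (fun n => 2 ^ n)^[k] (a ^ (k + j) * (2 ^ (k + j)) ^ (k + j))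

theorem numClasses_zero (a j : ℕ) : numClasses a 0 j = a ^ j * (2 ^ j) ^ j := by
  simp [numClasses]

theorem numClasses_succ (a k j : ℕ) : numClasses a (k + 1) j = 2 ^ numClasses a k (j + 1) := by
  simp only [numClasses, Function.iterate_succ_apply']
  rw [show k + 1 + j = k + (j + 1) by omega]

/-- With no round left, the class is the atomic type of the pebbles: their labels and their order.
With `k + 1` rounds left, it is the set of `k`-round classes reachable by placing one more pebble,
whence one exponential per round. -/
theorem exists_classifier [Fintype A] (k j : ℕ) :
    ∃ cl : PosWord A → (Fin j → ℕ) → Fin (numClasses (Fintype.card A) k j),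
      ∀ u v p q, (∀ m, p m ∈ u.dom) → (∀ m, q m ∈ v.dom) → cl u p = cl v q →
        EF u v k (List.ofFn fun m => (p m, q m)) := by
  classical
  induction k generalizing j with
  | zero =>
    have hcard : Fintype.card ((Fin j → A) × (Fin j → Fin j → Bool)) =
        numClasses (Fintype.card A) 0 j := by
      simp [numClasses_zero]
    refine ⟨fun u p => Fintype.equivFinOfCardEq hcard
      (fun m => u.lab (p m), fun m n => decide (p m ≤ p n)), fun u v p q hp hq h => ?_⟩
    have h := (Equiv.injective _) h
    rw [Prod.mk.injEq] at h
    simp only [EF, Compat, List.mem_ofFn, forall_exists_index, forall_apply_eq_imp_iff]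
    refine ⟨fun m => congrFun h.1 m, fun m n => ?_⟩
    simpa using congrFun (congrFun h.2 m) n
  | succ k ih =>
    obtain ⟨cl, hcl⟩ := ih (j + 1)
    have hcard : Fintype.card (Set (Fin (numClasses (Fintype.card A) k (j + 1)))) =
        numClasses (Fintype.card A) (k + 1) j := by
      simp [numClasses_succ]
    have hcl' : ∀ u v p q i i', (∀ m, p m ∈ u.dom) → (∀ m, q m ∈ v.dom) →
        i ∈ u.dom → i' ∈ v.dom → cl u (Fin.cons i p) = cl v (Fin.cons i' q) →
        EF u v k ((i, i') :: List.ofFn fun m => (p m, q m)) := by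
      intro u v p q i i' hp hq hi hi' h
      have := hcl _ _ _ _ (Fin.forall_fin_succ.2 ⟨hi, hp⟩) (Fin.forall_fin_succ.2 ⟨hi', hq⟩) h
      rw [List.ofFn_succ] at this
      simpa using this
    refine ⟨fun u p => Fintype.equivFinOfCardEq hcard
      {c | ∃ i ∈ u.dom, cl u (Fin.cons i p) = c}, fun u v p q hp hq h => ?_⟩
    have h := (Equiv.injective _) h
    have h₁ : ∀ i ∈ u.dom, ∃ i' ∈ v.dom, EF u v k ((i, i') :: List.ofFn fun m => (p m, q m)) := by
      intro i hi
      have : cl u (Fin.cons i p) ∈ {c | ∃ i ∈ u.dom, cl u (Fin.cons i p) = c} := ⟨i, hi, rfl⟩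
      rw [h] at this
      obtain ⟨i', hi', H⟩ := this
      exact ⟨i', hi', hcl' _ _ _ _ _ _ hp hq hi hi' H.symm⟩
    have h₂ : ∀ i' ∈ v.dom, ∃ i ∈ u.dom, EF u v k ((i, i') :: List.ofFn fun m => (p m, q m)) := by
      intro i' hi'
      have : cl v (Fin.cons i' q) ∈ {c | ∃ i ∈ v.dom, cl v (Fin.cons i q) = c} := ⟨i', hi', rfl⟩
      rw [← h] at this
      obtain ⟨i, hi, H⟩ := this
      exact ⟨i, hi, hcl' _ _ _ _ _ _ hp hq hi hi' H⟩
    refine ⟨?_, h₁, h₂⟩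
    -- Compatibility of the current pebbles is not recorded in the class. It follows from the reply
    -- to a move onto an existing pebble, and is void if there is none.
    cases j with
    | zero => simp [Compat]
    | succ j =>
      obtain ⟨i', -, H⟩ := h₁ _ (hp 0)
      exact H.compat.subset (List.subset_cons_self _ _)

/-- Every word is equivalent to a scattered subword of bounded length. -/
theorem exists_short_sublist [Fintype A] (lab : ℕ → A) (k : ℕ) (D : List ℕ)
    (hD : D.Pairwise (· < ·)) : ∃ E : List ℕ, E.Sublist D ∧
      E.length ≤ numClasses (Fintype.card A) k 0 ∧ EF ⟨D, lab⟩ ⟨E, lab⟩ k [] := by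
  obtain ⟨cl, hcl⟩ := exists_classifier (A := A) k 0
  induction hn : D.length using Nat.strong_induction_on generalizing D with
  | _ n ih =>
  by_cases hlen : D.length ≤ numClasses (Fintype.card A) k 0
  · exact ⟨D, List.Sublist.refl _, hlen, EF.refl _ _ (by simp)⟩
  -- Pigeonhole on the proper prefixes: two of them are equivalent, and by congruence the segment
  -- between their ends can be deleted.
  obtain ⟨i, j, hij, h⟩ := Fintype.exists_ne_map_eq_of_card_lt
    (fun i : Fin D.length => cl ⟨D.take i, lab⟩ Fin.elim0) (by simpa using hlen)
  wlog hlt : i < j generalizing i j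
  · exact this j i hij.symm h.symm (lt_of_le_of_ne (not_lt.1 hlt) hij.symm)
  have h₁ : EF ⟨D.take j, lab⟩ ⟨D.take i, lab⟩ k [] := by
    simpa using hcl _ _ _ _ (fun m => m.elim0) (fun m => m.elim0) h.symm
  have hjD : ∀ x ∈ D.take j, ∀ y ∈ D.drop j, x < y := by
    rw [← List.take_append_drop j D, List.pairwise_append] at hD
    exact hD.2.2
  have hsub : (D.take i ++ D.drop j).Sublist D := by
    conv_rhs => rw [← List.take_append_drop j D]
    exact (List.take_sublist_take_left hlt.le).append (List.Sublist.refl _)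
  have h₂ : EF ⟨D, lab⟩ ⟨D.take i ++ D.drop j, lab⟩ k [] := by
    have := EF.append (p₁ := []) (p₂ := []) (p := []) (k := k) (lu := lab) (lv := lab) hjD
      (E₁ := D.take i) (E₂ := D.drop j)
      (fun x hx y hy => hjD x ((List.take_sublist_take_left hlt.le).subset hx) y hy)
      (by simp) (by simp) h₁ (EF.refl _ _ (by simp)) (by simp)
    rwa [List.take_append_drop] at this
  obtain ⟨E, hE, hlE, h₃⟩ := ih _ (by
    have := i.2; have := j.2; have : i.1 < j.1 := hlt
    rw [← hn, List.length_append, List.length_take, List.length_drop]; omega)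
    _ (hD.sublist hsub) rfl
  exact ⟨E, hE.trans hsub, hlE, EF.trans (l := []) h₂ h₃⟩
end PosWord
end WFOLogic

/-! ### Words of maps and aperiodic sets of maps -/

namespace WFOLogic

namespace PosWord

variable {X : Type u}

/-- The composition of the labels of a word of maps, the first letter being applied first. -/
def eval (l : List ℕ) (lab : ℕ → X → X) (x : X) : X := l.foldl (fun x i => lab i x) x

@[simp] theorem eval_nil (lab : ℕ → X → X) (x : X) : eval [] lab x = x := rfl

@[simp] theorem eval_cons (i : ℕ) (l : List ℕ) (lab : ℕ → X → X) (x : X) :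
    eval (i :: l) lab x = eval l lab (lab i x) := rfl

theorem eval_append (l l' : List ℕ) (lab : ℕ → X → X) (x : X) :
    eval (l ++ l') lab x = eval l' lab (eval l lab x) := List.foldl_append

theorem eval_congr {l : List ℕ} {lab lab' : ℕ → X → X} (h : ∀ i ∈ l, lab i = lab' i) (x : X) :
    eval l lab x = eval l lab' x :=
  List.foldl_ext _ _ _ fun x i hi => by rw [h i hi]

theorem eval_mem {l : List ℕ} {lab : ℕ → X → X} {Y : Finset X}
    (h : ∀ i ∈ l, Set.MapsTo (lab i) Y Y) {x : X} (hx : x ∈ Y) : eval l lab x ∈ Y := by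
  induction l generalizing x with
  | nil => exact hx
  | cons i l ih =>
    exact ih (fun j hj => h j (List.mem_cons_of_mem _ hj)) (h i List.mem_cons_self hx)

/-- A set of maps that is closed under composition and whose elements are aperiodic. -/
structure AperiodicSet (H : Set (X → X)) : Prop where
  id_mem : id ∈ H
  comp_mem : ∀ g ∈ H, ∀ h ∈ H, g ∘ h ∈ H
  aperiodic : ∀ h ∈ H, ∃ m : ℕ, h^[m + 1] = h^[m]

/-- The maps that preserve `Y` and agree on `Y` with an element of `H`. -/
def restrictTo (H : Set (X → X)) (Y : Finset X) : Set (X → X) :=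
  {s | Set.MapsTo s Y Y ∧ ∃ h ∈ H, Set.EqOn s h Y}

theorem eval_eqOn {H : Set (X → X)} (hH : AperiodicSet H) {Y : Finset X} {l : List ℕ}
    {lab : ℕ → X → X} (h : ∀ i ∈ l, lab i ∈ restrictTo H Y) :
    ∃ g ∈ H, Set.EqOn (eval l lab) g Y := by
  induction l with
  | nil => exact ⟨id, hH.id_mem, fun _ _ => rfl⟩
  | cons i l ih =>
    obtain ⟨g, hg, hgl⟩ := ih fun j hj => h j (List.mem_cons_of_mem _ hj)
    obtain ⟨hm, f, hf, hfi⟩ := h i List.mem_cons_self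
    refine ⟨g ∘ f, hH.comp_mem _ hg _ hf, fun x hx => ?_⟩
    rw [eval_cons, hgl (hm hx), hfi hx, Function.comp_apply]

/-- If `c(Y)` had as many points as `Y`, then `c` would map `Y` onto itself, so `y` would be of the
form `c^[m] z` with `z ∈ Y`; then `c y = c^[m + 1] z = c^[m] z = y` by aperiodicity. -/
theorem card_image_lt [DecidableEq X] {H : Set (X → X)} (hH : AperiodicSet H) {Y : Finset X}
    {c : X → X} (hc : c ∈ restrictTo H Y) {y : X} (hy : y ∈ Y) (hcy : c y ≠ y) :
    (Y.image c).card < Y.card := by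
  obtain ⟨hm, h, hh, heq⟩ := hc
  have hsub : Y.image c ⊆ Y := Finset.image_subset_iff.2 hm
  refine lt_of_not_ge fun hle => hcy ?_
  have himg := Finset.eq_of_subset_of_card_le hsub hle
  obtain ⟨m, hper⟩ := hH.aperiodic h hh
  have hit : ∀ (n : ℕ) (x : X), x ∈ Y → c^[n] x ∈ Y ∧ c^[n] x = h^[n] x := by
    intro n x hx
    induction n with
    | zero => exact ⟨hx, rfl⟩
    | succ n ih =>
      rw [Function.iterate_succ_apply', Function.iterate_succ_apply', ← ih.2]
      exact ⟨hm ih.1, heq ih.1⟩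
  have hsurj : ∀ (n : ℕ) (x : X), x ∈ Y → ∃ z ∈ Y, c^[n] z = x := by
    intro n
    induction n with
    | zero => exact fun x hx => ⟨x, hx, rfl⟩
    | succ n ih =>
      intro x hx
      obtain ⟨z, hz, rfl⟩ := ih x hx
      rw [← himg] at hz
      obtain ⟨z', hz', rfl⟩ := Finset.mem_image.1 hz
      exact ⟨z', hz', rfl⟩
  obtain ⟨z, hz, rfl⟩ := hsurj m y hy
  rw [← Function.iterate_succ_apply' c, (hit _ z hz).2, (hit _ z hz).2, hper]

/-! ### Factorization of a word at the occurrences of a letter -/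

section Factorization

open Classical in
/-- The positions of the occurrences of `c`. -/
noncomputable def occ (D : List ℕ) (lab : ℕ → X → X) (c : X → X) : List ℕ :=
  D.filter fun i => lab i = c

open Classical in
/-- The block of positions before `i` and after the previous occurrence of `c`. -/
noncomputable def block (D : List ℕ) (lab : ℕ → X → X) (c : X → X) (i : ℕ) : List ℕ :=
  D.filter fun j => j < i ∧ ∀ k ∈ D, j ≤ k → k < i → lab k ≠ c

open Classical in
/-- The block of positions after the last occurrence of `c`. -/
noncomputable def lastBlock (D : List ℕ) (lab : ℕ → X → X) (c : X → X) : List ℕ :=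
  D.filter fun j => ∀ k ∈ D, j ≤ k → lab k ≠ c

open Classical in
/-- The action on `Y` of the block before `i` followed by the letter `c` at `i`. -/
noncomputable def blockLab (D : List ℕ) (lab : ℕ → X → X) (c : X → X) (Y : Finset X) (i : ℕ) :
    X → X :=
  fun x => if x ∈ Y then c (eval (block D lab c i) lab x) else x

/-- Induction on appending a position: an occurrence of `c` turns the current last block into the
block before it and empties the last block; any other letter extends the last block. The second
conclusion is carried along because `blockLab` has the intended value only on `Y`. -/
theorem eval_factorization {D : List ℕ} (hD : D.Pairwise (· < ·)) {lab : ℕ → X → X} (c : X → X)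
    {Y : Finset X} (hY : ∀ i ∈ D, Set.MapsTo (lab i) Y Y) {x : X} (hx : x ∈ Y) :
    eval D lab x = eval (lastBlock D lab c) lab (eval (occ D lab c) (blockLab D lab c Y) x) ∧
      eval (occ D lab c) (blockLab D lab c Y) x ∈ Y := by
  induction D using List.reverseRecOn with
  | nil => exact ⟨rfl, hx⟩
  | append_singleton D i ih =>
    rw [List.pairwise_append] at hD
    obtain ⟨hD, -, hlt⟩ := hD
    have hlt : ∀ j ∈ D, j < i := fun j hj => hlt j hj i (List.mem_singleton_self i)
    obtain ⟨ih, ihY⟩ := ih hD fun j hj => hY j (List.mem_append_left _ hj)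
    have hb : ∀ j ∈ D, block (D ++ [i]) lab c j = block D lab c j := by
      intro j hj
      have h₁ := hlt j hj
      have h₂ : ¬ i < j := h₁.not_gt
      rw [block, block, List.filter_append]
      simp only [List.filter_singleton, h₂, false_and, decide_false, cond_false, List.append_nil]
      refine List.filter_congr fun k _ => ?_
      rw [decide_eq_decide]
      simp only [List.mem_append, List.mem_singleton, or_imp, forall_and, forall_eq]
      simp [h₂]
    have hbi : block (D ++ [i]) lab c i = lastBlock D lab c := by
      rw [block, lastBlock, List.filter_append]
      simp only [List.filter_singleton, lt_irrefl, false_and, decide_false, cond_false,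
        List.append_nil]
      refine List.filter_congr fun j hj => ?_
      rw [decide_eq_decide]
      simp only [List.mem_append, List.mem_singleton, or_imp, forall_and, forall_eq]
      simp only [hlt j hj, lt_irrefl, false_imp_iff, imp_true_iff, and_true, true_and]
      exact ⟨fun h k hk hjk => h k hk hjk (hlt k hk), fun h k hk hjk _ => h k hk hjk⟩
    have hocc : eval (occ D lab c) (blockLab (D ++ [i]) lab c Y) x =
        eval (occ D lab c) (blockLab D lab c Y) x := by
      refine eval_congr (fun j hj => ?_) x
      funext z
      rw [blockLab, blockLab, hb j (List.mem_of_mem_filter hj)]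
    rw [eval_append, ih]
    by_cases hi : lab i = c
    · have h₁ : occ (D ++ [i]) lab c = occ D lab c ++ [i] := by
        simp [occ, List.filter_append, hi]
      have h₂ : lastBlock (D ++ [i]) lab c = [] := by
        rw [lastBlock, List.filter_eq_nil_iff]
        intro j hj
        simp only [decide_eq_true_eq, not_forall, not_not]
        refine ⟨i, by simp, ?_, hi⟩
        rcases List.mem_append.1 hj with hj | hj
        · exact (hlt j hj).le
        · exact (List.mem_singleton.1 hj).le
      have h₃ : eval (occ (D ++ [i]) lab c) (blockLab (D ++ [i]) lab c Y) x =
          lab i (eval (lastBlock D lab c) lab (eval (occ D lab c) (blockLab D lab c Y) x)) := by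
        rw [h₁, eval_append, hocc, eval_cons, eval_nil, blockLab, if_pos ihY, hbi, hi]
      rw [h₂, h₃]
      refine ⟨rfl, hY i (by simp) (eval_mem (fun j hj => hY j ?_) ihY)⟩
      exact List.mem_append_left _ (List.mem_of_mem_filter hj)
    · have h₁ : occ (D ++ [i]) lab c = occ D lab c := by
        simp [occ, List.filter_append, hi]
      have h₂ : lastBlock (D ++ [i]) lab c = lastBlock D lab c ++ [i] := by
        rw [lastBlock, lastBlock, List.filter_append]
        congr 1
        · refine List.filter_congr fun j hj => ?_
          rw [decide_eq_decide]
          simp only [List.mem_append, List.mem_singleton, or_imp, forall_and, forall_eq]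
          exact ⟨fun h => h.1, fun h => ⟨h, fun _ => hi⟩⟩
        · rw [List.filter_eq_self]
          intro j hj
          obtain rfl := List.mem_singleton.1 hj
          simp only [decide_eq_true_eq, List.mem_append, List.mem_singleton]
          rintro k (hk | rfl) hjk
          · exact absurd (hlt k hk) (by omega)
          · exact hi
      rw [h₁, h₂, hocc, eval_append]
      exact ⟨rfl, ihY⟩

end Factorization
end PosWord
end WFOLogic

/-! ### Equivalent words act alike over an aperiodic set -/

namespace WFOLogic

namespace PosWord

variable {X : Type u}

theorem mem_occ {D : List ℕ} {lab : ℕ → X → X} {c : X → X} {i : ℕ} :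
    i ∈ occ D lab c ↔ i ∈ D ∧ lab i = c := by simp [occ]

/-- The definition of the last block has a single quantifier over positions, so one more round
decides membership. The same holds for `block`, with a second pebble on the occurrence of `c` that
ends it. -/
theorem mem_lastBlock_iff {u v : PosWord (X → X)} {c : X → X} {i j : ℕ} (hi : i ∈ u.dom)
    (hj : j ∈ v.dom) (h : EF u v 1 [(i, j)]) :
    i ∈ lastBlock u.dom u.lab c ↔ j ∈ lastBlock v.dom v.lab c := by
  simp only [lastBlock, List.mem_filter, decide_eq_true_eq, hi, hj, true_and]
  constructor
  · intro H k hk hjk hc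
    obtain ⟨l, hl, G⟩ := h.2.2 k hk
    exact H l hl ((G.compat.2 (i, j) (by simp) (l, k) (by simp)).2 hjk)
      ((G.compat.1 (l, k) (by simp)).trans hc)
  · intro H k hk hjk hc
    obtain ⟨l, hl, G⟩ := h.2.1 k hk
    exact H l hl ((G.compat.2 (i, j) (by simp) (k, l) (by simp)).1 hjk)
      ((G.compat.1 (k, l) (by simp)).symm.trans hc)

theorem lt_iff_of_compat {A : Type v} {u v : PosWord A} {p : List (ℕ × ℕ)} (h : Compat u v p)
    {i j k l : ℕ} (hij : (i, j) ∈ p) (hkl : (k, l) ∈ p) : i < k ↔ j < l := by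
  have := h.2 _ hkl _ hij
  simp only at this
  omega

theorem mem_block_iff {u v : PosWord (X → X)} {c : X → X} {i j i' j' : ℕ} (hi' : i' ∈ u.dom)
    (hj' : j' ∈ v.dom) (h : EF u v 1 [(i', j'), (i, j)]) :
    i' ∈ block u.dom u.lab c i ↔ j' ∈ block v.dom v.lab c j := by
  simp only [block, List.mem_filter, decide_eq_true_eq, hi', hj', true_and]
  refine and_congr (lt_iff_of_compat h.compat (by simp) (by simp)) ⟨?_, ?_⟩
  · intro H k hk hjk hkj hc
    obtain ⟨l, hl, G⟩ := h.2.2 k hk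
    exact H l hl ((G.compat.2 (i', j') (by simp) (l, k) (by simp)).2 hjk)
      ((lt_iff_of_compat G.compat (by simp) (by simp)).2 hkj)
      ((G.compat.1 (l, k) (by simp)).trans hc)
  · intro H k hk hjk hkj hc
    obtain ⟨l, hl, G⟩ := h.2.1 k hk
    exact H l hl ((G.compat.2 (i', j') (by simp) (k, l) (by simp)).1 hjk)
      ((lt_iff_of_compat G.compat (by simp) (by simp)).1 hkj)
      ((G.compat.1 (k, l) (by simp)).symm.trans hc)

/-- A number of rounds after which equivalent words over `s` letters act in the same way on a set
of `n` points; `K` bounds the number of all maps. -/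
def gameRank (K : ℕ) : ℕ → ℕ → ℕ
  | 0, _ => 0
  | n + 1, s => s * (gameRank K n K + 2)

theorem eval_eq_self {l : List ℕ} {lab : ℕ → X → X} {x : X} (h : ∀ i ∈ l, lab i x = x) :
    eval l lab x = x := by
  induction l with
  | nil => rfl
  | cons i l ih =>
    rw [eval_cons, h i List.mem_cons_self, ih fun j hj => h j (List.mem_cons_of_mem _ hj)]

/-- Because `c` comes last, the map lands in `c(Y)`; this is why a block is grouped with the `c`
that follows it. -/
theorem blockLab_mem_restrictTo [DecidableEq X] {H : Set (X → X)} (hH : AperiodicSet H) {Y : Finset X}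
    {D : List ℕ} {lab : ℕ → X → X} {c : X → X} (hc : c ∈ restrictTo H Y)
    (h : ∀ i ∈ D, lab i ∈ restrictTo H Y) (i : ℕ) :
    blockLab D lab c Y i ∈ restrictTo H (Y.image c) := by
  have hsub : Y.image c ⊆ Y := Finset.image_subset_iff.2 hc.1
  have hb : ∀ j ∈ block D lab c i, lab j ∈ restrictTo H Y :=
    fun j hj => h j (List.mem_of_mem_filter hj)
  obtain ⟨g, hg, hgl⟩ := eval_eqOn hH hb
  obtain ⟨f, hf, hfc⟩ := hc.2
  refine ⟨fun x hx => ?_, f ∘ g, hH.comp_mem _ hf _ hg, fun x hx => ?_⟩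
  · rw [blockLab, if_pos (hsub hx)]
    exact Finset.mem_image_of_mem c (eval_mem (fun j hj => (hb j hj).1) (hsub hx))
  · have hx' : x ∈ Y := hsub hx
    have := eval_mem (fun j hj => (hb j hj).1) hx'
    rw [blockLab, if_pos hx', hfc this, hgl hx', Function.comp_apply]

/-- Over an aperiodic set of maps, words that are equivalent for sufficiently many rounds act in
the same way. -/
theorem EF.eval_eq [Fintype X] [DecidableEq X] {H : Set (X → X)} (hH : AperiodicSet H)
    {n s : ℕ} {Y : Finset X} (hY : Y.card ≤ n) {S : Finset (X → X)} (hS : S.card ≤ s)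
    (hSH : ∀ c ∈ S, c ∈ restrictTo H Y) {u v : PosWord (X → X)}
    (hu : u.dom.Pairwise (· < ·)) (hv : v.dom.Pairwise (· < ·))
    (huS : ∀ i ∈ u.dom, u.lab i ∈ S) (hvS : ∀ i ∈ v.dom, v.lab i ∈ S)
    (h : EF u v (gameRank (Fintype.card (X → X)) n s) []) {y : X} (hy : y ∈ Y) :
    eval u.dom u.lab y = eval v.dom v.lab y := by
  classical
  induction n generalizing s Y S u v y with
  | zero =>
    obtain rfl := Finset.card_eq_zero.1 (Nat.le_zero.1 hY)
    simp at hy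
  | succ n ihn =>
  induction s generalizing S u v y with
  | zero =>
    obtain rfl := Finset.card_eq_zero.1 (Nat.le_zero.1 hS)
    rw [List.eq_nil_iff_forall_not_mem.2 fun i hi => Finset.notMem_empty _ (huS i hi),
      List.eq_nil_iff_forall_not_mem.2 fun i hi => Finset.notMem_empty _ (hvS i hi)]
    rfl
  | succ s ihs =>
  by_cases hid : ∀ c ∈ S, ∀ z ∈ Y, c z = z
  -- If every letter fixes `Y` pointwise, both words act as the identity. Otherwise some letter
  -- moves a point, and it is the one to cut at.
  · rw [eval_eq_self fun i hi => hid _ (huS i hi) y hy,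
      eval_eq_self fun i hi => hid _ (hvS i hi) y hy]
  push Not at hid
  obtain ⟨c, hcS, z, hz, hcz⟩ := hid
  have hc := hSH c hcS
  have hY' : (Y.image c).card ≤ n := by
    have := card_image_lt hH hc hz hcz
    omega
  have huY : ∀ i ∈ u.dom, Set.MapsTo (u.lab i) Y Y := fun i hi => (hSH _ (huS i hi)).1
  have hvY : ∀ i ∈ v.dom, Set.MapsTo (v.lab i) Y Y := fun i hi => (hSH _ (hvS i hi)).1
  set K := Fintype.card (X → X) with hK
  obtain ⟨r, hr⟩ : ∃ r, gameRank K (n + 1) s = r := ⟨_, rfl⟩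
  obtain ⟨g, hg⟩ : ∃ g, gameRank K n K = g := ⟨_, rfl⟩
  -- The budget: `r` rounds for words without `c`, one for defining the blocks, one for pebbling the
  -- first occurrence of `c`, and `g` for the word of blocks acting on `c(Y)`.
  have hN : gameRank K (n + 1) (s + 1) = r + g + 2 := by
    rw [← hr, ← hg, gameRank, gameRank]; ring
  rw [hN] at h
  rw [hr] at ihs
  have hsub : ∀ {D E : List ℕ}, D.Sublist u.dom → E.Sublist v.dom →
      (∀ i ∈ D, u.lab i ≠ c) → (∀ i ∈ E, v.lab i ≠ c) →
      EF ⟨D, u.lab⟩ ⟨E, v.lab⟩ r [] → ∀ x ∈ Y, eval D u.lab x = eval E v.lab x := by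
    intro D E hD hE hDc hEc hEF x hx
    refine ihs (S := S.erase c) (u := ⟨D, u.lab⟩) (v := ⟨E, v.lab⟩) ?_ ?_ (hu.sublist hD)
      (hv.sublist hE) ?_ ?_ hEF hx
    · rw [Finset.card_erase_of_mem hcS]; omega
    · exact fun d hd => hSH d (Finset.mem_of_mem_erase hd)
    · exact fun i hi => Finset.mem_erase.2 ⟨hDc i hi, huS i (hD.subset hi)⟩
    · exact fun i hi => Finset.mem_erase.2 ⟨hEc i hi, hvS i (hE.subset hi)⟩
  have hlast : ∀ x ∈ Y, eval (lastBlock u.dom u.lab c) u.lab x =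
      eval (lastBlock v.dom v.lab c) v.lab x := by
    refine hsub (D := lastBlock u.dom u.lab c) (E := lastBlock v.dom v.lab c)
      List.filter_sublist List.filter_sublist ?_ ?_ ?_
    · intro i hi
      simp only [lastBlock, List.mem_filter, decide_eq_true_eq] at hi
      exact hi.2 i hi.1 le_rfl
    · intro i hi
      simp only [lastBlock, List.mem_filter, decide_eq_true_eq] at hi
      exact hi.2 i hi.1 le_rfl
    · refine EF.definable (u := u) (v := v) (u' := ⟨lastBlock u.dom u.lab c, u.lab⟩)
        (v' := ⟨lastBlock v.dom v.lab c, v.lab⟩) List.filter_sublist.subset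
        List.filter_sublist.subset (k := r) (p := []) (p₀ := []) (r := 1) (fun i hi j hj hij =>
        ⟨mem_lastBlock_iff hi hj hij, fun _ _ => hij.compat.1 (i, j) (by simp)⟩) (by simp)
        (h.mono (by omega))
  have hblock : ∀ i ∈ u.dom, ∀ j ∈ v.dom, EF u v (r + 1) [(i, j)] →
      blockLab u.dom u.lab c Y i = blockLab v.dom v.lab c Y j := by
    intro i hi j hj hij
    -- The labels have to agree as functions on all of `X`. Off `Y` both are the identity by the
    -- default value in `blockLab`; on `Y` the two blocks are equivalent words without `c`.
    funext x
    rw [blockLab, blockLab]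
    split_ifs with hx
    · congr 1
      refine hsub (D := block u.dom u.lab c i) (E := block v.dom v.lab c j)
        List.filter_sublist List.filter_sublist ?_ ?_ ?_ x hx
      · intro k hk
        simp only [block, List.mem_filter, decide_eq_true_eq] at hk
        exact hk.2.2 k hk.1 le_rfl hk.2.1
      · intro k hk
        simp only [block, List.mem_filter, decide_eq_true_eq] at hk
        exact hk.2.2 k hk.1 le_rfl hk.2.1
      · exact EF.definable (u := u) (v := v) (u' := ⟨block u.dom u.lab c i, u.lab⟩)
          (v' := ⟨block v.dom v.lab c j, v.lab⟩) List.filter_sublist.subset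
          List.filter_sublist.subset (k := r) (p := []) (p₀ := [(i, j)]) (r := 1) (fun k hk l hl hkl =>
          ⟨mem_block_iff hk hl hkl, fun _ _ => hkl.compat.1 (k, l) (by simp)⟩) (by simp) hij
    · rfl
  obtain ⟨hue, huy⟩ := eval_factorization hu c huY hy
  obtain ⟨hve, hvy⟩ := eval_factorization hv c hvY hy
  rw [hue, hve, hlast _ huy]
  congr 1
  have huo : (occ u.dom u.lab c).Pairwise (· < ·) := hu.sublist List.filter_sublist
  have hvo : (occ v.dom v.lab c).Pairwise (· < ·) := hv.sublist List.filter_sublist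
  have hmu : ∀ i, i ∈ occ u.dom u.lab c ↔ _ := fun i => mem_occ
  have hmv : ∀ i, i ∈ occ v.dom v.lab c ↔ _ := fun i => mem_occ
  -- The first occurrence of `c` is split off: its label carries `Y` into `c(Y)`, and only from
  -- there on does the smaller set apply.
  rcases hou : occ u.dom u.lab c with _ | ⟨i, D⟩
  · rcases hov : occ v.dom v.lab c with _ | ⟨j, E⟩
    · rfl
    · obtain ⟨hj, hjc⟩ := (hmv j).1 (by simp [hov])
      obtain ⟨i, hi, hij⟩ := h.2.2 j hj
      have := (hmu i).2 ⟨hi, (hij.compat.1 (i, j) (by simp)).trans hjc⟩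
      simp [hou] at this
  rw [hou] at huo hmu
  obtain ⟨hi, hic⟩ := (hmu i).1 List.mem_cons_self
  obtain ⟨j', hj', hij⟩ := h.2.1 i hi
  have hj'o := (hmv j').2 ⟨hj', (hij.compat.1 (i, j') (by simp)).symm.trans hic⟩
  rcases hov : occ v.dom v.lab c with _ | ⟨j, E⟩
  · simp [hov] at hj'o
  rw [hov] at hvo hmv hj'o
  obtain ⟨hj, hjc⟩ := (hmv j).1 List.mem_cons_self
  rw [List.pairwise_cons] at huo hvo
  -- Duplicator must answer the first occurrence by the first occurrence: an earlier `c` before `j'`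
  -- would be answered by a `c` before `i`.
  obtain rfl : j' = j := by
    rcases List.mem_cons.1 hj'o with h' | h'
    · exact h'
    obtain ⟨i', hi', G⟩ := hij.2.2 j hj
    have hlt := (lt_iff_of_compat G.compat (i := i') (k := i) (by simp) (by simp)).2 (hvo.1 _ h')
    rcases List.mem_cons.1 ((hmu i').2 ⟨hi', (G.compat.1 (i', j) (by simp)).trans hjc⟩) with h | h
    · omega
    · have := huo.1 _ h
      omega
  have hmem : ∀ i' ∈ u.dom, ∀ k ∈ v.dom, EF u v (r + 1) [(i', k), (i, j')] →
      (i' ∈ D ↔ k ∈ E) := by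
    intro i' hi' k hk G
    have e₁ : i' ∈ D ↔ u.lab i' = c ∧ i < i' := by
      constructor
      · exact fun h => ⟨((hmu i').1 (List.mem_cons_of_mem _ h)).2, huo.1 _ h⟩
      · rintro ⟨h, h'⟩
        exact (List.mem_cons.1 ((hmu i').2 ⟨hi', h⟩)).resolve_left (by omega)
    have e₂ : k ∈ E ↔ v.lab k = c ∧ j' < k := by
      constructor
      · exact fun h => ⟨((hmv k).1 (List.mem_cons_of_mem _ h)).2, hvo.1 _ h⟩
      · rintro ⟨h, h'⟩
        exact (List.mem_cons.1 ((hmv k).2 ⟨hk, h⟩)).resolve_left (by omega)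
    rw [e₁, e₂, G.compat.1 (i', k) (by simp),
      lt_iff_of_compat G.compat (i := i) (j := j') (k := i') (l := k) (by simp) (by simp)]
  have hDu : D ⊆ u.dom := fun k hk => ((hmu k).1 (List.mem_cons_of_mem _ hk)).1
  have hEv : E ⊆ v.dom := fun k hk => ((hmv k).1 (List.mem_cons_of_mem _ hk)).1
  rw [eval_cons, eval_cons, ← hblock i hi j' hj' (hij.mono (by omega))]
  -- The new letters are block maps, of which only the trivial count `K` is known, so the number of
  -- letters restarts at `K` while the set has shrunk.
  refine ihn (s := K) (Y := Y.image c) (u := ⟨D, _⟩) (v := ⟨E, _⟩) hY'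
    (S := Finset.univ.filter (· ∈ restrictTo H (Y.image c))) (Finset.card_filter_le _ _)
    (by simp) huo.2 hvo.2 ?_ ?_ ?_ ?_
  · exact fun k _ => Finset.mem_filter.2 ⟨Finset.mem_univ _,
      blockLab_mem_restrictTo hH hc (fun i hi => hSH _ (huS i hi)) k⟩
  · exact fun k _ => Finset.mem_filter.2 ⟨Finset.mem_univ _,
      blockLab_mem_restrictTo hH hc (fun i hi => hSH _ (hvS i hi)) k⟩
  · rw [hg]
    refine EF.definable (u := u) (v := v) hDu hEv (p₀ := [(i, j')]) (r := r + 1)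
      (fun k hk l hl hkl => ⟨hmem k hk l hl hkl, fun _ _ => hblock k hk l hl
        (hkl.subset (by simp))⟩) (by simp) (hij.mono (by omega))
  · rw [blockLab, if_pos hy]
    exact Finset.mem_image_of_mem c (eval_mem (fun k hk => huY k (List.mem_of_mem_filter hk)) hy)

end PosWord
end WFOLogic

/-! ### Reachability maps and the transfer of marked runs -/

namespace WFOLogic

/-- The word with positions `0, …, |w| - 1`. -/
def PosWord.ofList {α : Type v} (w : List α) : PosWord (Option α) :=
  ⟨List.range w.length, fun i => w[i]?⟩

/-- Passing to subdomains that are definable without quantifiers from the pebbles. -/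
theorem PosWord.EF.filter {A : Type v} {u v : PosWord A} {k : ℕ} {p : List (ℕ × ℕ)}
    (h : EF u v k p) {f g : ℕ → Bool}
    (hfg : ∀ i ∈ u.dom, ∀ j ∈ v.dom, Compat u v ((i, j) :: p) → f i = g j) :
    EF ⟨u.dom.filter f, u.lab⟩ ⟨v.dom.filter g, v.lab⟩ k [] := by
  refine EF.definable (u := u) (v := v) (u' := ⟨u.dom.filter f, u.lab⟩)
    (v' := ⟨v.dom.filter g, v.lab⟩) List.filter_sublist.subset List.filter_sublist.subset
    (k := k) (p := []) (r := 0) (p₀ := p) (fun i hi j hj hij => ⟨?_, fun _ _ =>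
      hij.1 (i, j) List.mem_cons_self⟩) (by simp) h
  simp [List.mem_filter, hi, hj, hfg i hi j hj hij]

theorem PosWord.EF.relabel {A : Type u} {B : Type v} {u v : PosWord A} {k : ℕ}
    (h : EF u v k []) (f : A → B) :
    EF ⟨u.dom, fun i => f (u.lab i)⟩ ⟨v.dom, fun i => f (v.lab i)⟩ k [] :=
  EF.definable (u := u) (v := v) (u' := ⟨u.dom, fun i => f (u.lab i)⟩)
    (v' := ⟨v.dom, fun i => f (v.lab i)⟩) (List.Subset.refl _) (List.Subset.refl _)
    (k := k) (p := []) (r := 0) (p₀ := []) (fun i hi j hj hij => ⟨iff_of_true hi hj, fun _ _ =>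
      congrArg f (hij.1 (i, j) List.mem_cons_self)⟩) (by simp) h

namespace WeightedAutomaton

variable {Q : Type u} {α : Type v} {R : Type w} (A : WeightedAutomaton Q α R)

theorem isRun_append {p q : Q} {ρ ρ' : List A.trans} :
    A.IsRun p (ρ ++ ρ') q ↔ ∃ r, A.IsRun p ρ r ∧ A.IsRun r ρ' q := by
  induction ρ generalizing p with
  | nil => simp [IsRun]
  | cons δ ρ ih => simp [IsRun, ih, and_assoc]

/-- The set of states reachable from `S` by reading `u`. -/
def reach (u : List α) (S : Set Q) : Set Q := {t | ∃ s ∈ S, u ∈ A.lang s t}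

theorem mem_reach_singleton {u : List α} {s t : Q} : t ∈ A.reach u {s} ↔ u ∈ A.lang s t := by
  simp [reach]

theorem reach_nil : A.reach [] = id := by
  funext S
  ext t
  simp only [reach, lang, runs, Set.mem_ofPred_eq, id]
  constructor
  · rintro ⟨s, hs, ρ, hρ, h⟩
    obtain rfl := List.map_eq_nil_iff.1 h
    obtain rfl : s = t := hρ
    exact hs
  · exact fun h => ⟨t, h, [], rfl, rfl⟩

theorem reach_append (u v : List α) : A.reach (u ++ v) = A.reach v ∘ A.reach u := by
  funext S
  ext t
  simp only [reach, lang, runs, Set.mem_ofPred_eq, Function.comp_apply]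
  constructor
  · rintro ⟨s, hs, ρ, hρ, h⟩
    obtain ⟨ρ₁, ρ₂, rfl, h₁, h₂⟩ := List.map_eq_append_iff.1 h
    obtain ⟨r, hr₁, hr₂⟩ := A.isRun_append.1 hρ
    exact ⟨r, ⟨s, hs, ρ₁, hr₁, h₁⟩, ρ₂, hr₂, h₂⟩
  · rintro ⟨r, ⟨s, hs, ρ₁, hr₁, h₁⟩, ρ₂, hr₂, h₂⟩
    exact ⟨s, hs, ρ₁ ++ ρ₂, A.isRun_append.2 ⟨r, hr₁, hr₂⟩, by
      rw [List.map_append, h₁, h₂]⟩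

theorem reach_flatten_replicate (u : List α) (m : ℕ) :
    A.reach (List.replicate m u).flatten = (A.reach u)^[m] := by
  induction m with
  | zero => exact A.reach_nil
  | succ m ih => rw [List.replicate_succ, List.flatten_cons, reach_append, ih]; rfl

-- The set reached from `S` is the union of those reached from its elements, so the condition on
-- pairs of states becomes an identity between iterates of `reach u`. The empty word, excluded
-- there, acts as the identity.
variable {A} in
theorem Aperiodic.aperiodicSet (h : A.Aperiodic) : PosWord.AperiodicSet (Set.range A.reach) := by
  refine ⟨⟨[], A.reach_nil⟩, ?_, ?_⟩
  · rintro _ ⟨u, rfl⟩ _ ⟨v, rfl⟩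
    exact ⟨v ++ u, A.reach_append v u⟩
  · obtain ⟨m, -, hm⟩ := h
    rintro _ ⟨u, rfl⟩
    rcases eq_or_ne u [] with rfl | hu
    · exact ⟨0, by rw [reach_nil]; rfl⟩
    · refine ⟨m, ?_⟩
      rw [← reach_flatten_replicate, ← reach_flatten_replicate]
      funext S
      ext t
      simp only [reach, Set.mem_ofPred_eq]
      exact exists_congr fun s => and_congr_right fun _ => (hm s t u hu).symm

/-- The action of an optional letter on sets of states. -/
def act (o : Option α) : Set Q → Set Q := A.reach o.toList

theorem eval_act {w : List α} {l : List ℕ} {x : List α}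
    (h : l.map (fun i => w[i]?) = x.map some) (S : Set Q) :
    PosWord.eval l (fun i => A.act w[i]?) S = A.reach x S := by
  induction l generalizing x S with
  | nil =>
    obtain rfl : x = [] := by simpa using h.symm
    rw [reach_nil]; rfl
  | cons i l ih =>
    cases x with
    | nil => simp at h
    | cons a x =>
      rw [List.map_cons, List.map_cons, List.cons.injEq] at h
      rw [PosWord.eval_cons, ih h.2, ← List.singleton_append, reach_append, Function.comp_apply,
        act, h.1]
      rfl

/-- A number of rounds after which equivalent words act in the same way on the subsets of a set
of `n` states. -/
def roundBound (n : ℕ) : ℕ :=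
  PosWord.gameRank ((2 ^ n) ^ 2 ^ n) (2 ^ n) ((2 ^ n) ^ 2 ^ n)

-- The invariance theorem for the full set of points `Set Q`: there are `2 ^ n` points and `(2 ^ n)
-- ^ 2 ^ n` maps, the constants in `roundBound`. Arbitrary position lists are allowed so that the
-- two sides of a marked position need no renumbering.
open PosWord in
theorem reach_eq_of_EF [Finite Q] (hA : A.Aperiodic) {w v w' v' : List α} {D E : List ℕ}
    (hD : D.Pairwise (· < ·)) (hE : E.Pairwise (· < ·))
    (hw : D.map (fun i => w[i]?) = w'.map some) (hv : E.map (fun i => v[i]?) = v'.map some)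
    (h : EF ⟨D, fun i => w[i]?⟩ ⟨E, fun i => v[i]?⟩ (roundBound (Nat.card Q)) []) :
    A.reach w' = A.reach v' := by
  classical
  have := Fintype.ofFinite Q
  funext S
  rw [← A.eval_act hw, ← A.eval_act hv]
  have hmem : ∀ o : Option α, A.act o ∈ restrictTo (Set.range A.reach) Finset.univ := by
    intro o
    refine ⟨fun _ _ => by simp, A.act o, ⟨o.toList, rfl⟩, fun _ _ => rfl⟩
  have hcard : Fintype.card (Set Q → Set Q) = (2 ^ Nat.card Q) ^ 2 ^ Nat.card Q := by
    simp
  have hcard' : (Finset.univ : Finset (Set Q)).card = 2 ^ Nat.card Q := by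
    simp
  refine EF.eval_eq (u := ⟨D, fun i => A.act w[i]?⟩) (v := ⟨E, fun i => A.act v[i]?⟩)
    hA.aperiodicSet (n := 2 ^ Nat.card Q) (s := (2 ^ Nat.card Q) ^ 2 ^ Nat.card Q)
    hcard'.le (S := Finset.univ.filter (· ∈ restrictTo (Set.range A.reach) Finset.univ))
    ((Finset.card_filter_le _ _).trans hcard.le) (by simp) hD hE
    (fun _ _ => Finset.mem_filter.2 ⟨Finset.mem_univ _, hmem _⟩)
    (fun _ _ => Finset.mem_filter.2 ⟨Finset.mem_univ _, hmem _⟩) ?_ (Finset.mem_univ S)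
  rw [hcard]
  exact EF.relabel h A.act

end WeightedAutomaton

namespace PosWord

variable {α : Type v}

theorem range_filter_lt (w₁ w₂ : List α) (a : α) :
    ((List.range (w₁ ++ a :: w₂).length).filter fun i => decide (i < w₁.length)).map
      (fun i => (w₁ ++ a :: w₂)[i]?) = w₁.map some := by
  rw [List.length_append, List.range_add, List.filter_append, List.filter_eq_self.2 (by simp),
    List.filter_eq_nil_iff.2 (by simp), List.append_nil]
  refine List.ext_getElem? fun i => ?_
  rcases lt_or_ge i w₁.length with h | h
  · simp [h, List.getElem?_append_left]
  · simp [h]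

theorem range_filter_gt (w₁ w₂ : List α) (a : α) :
    ((List.range (w₁ ++ a :: w₂).length).filter fun i => decide (w₁.length < i)).map
      (fun i => (w₁ ++ a :: w₂)[i]?) = w₂.map some := by
  rw [show (w₁ ++ a :: w₂).length = (w₁.length + 1) + w₂.length by simp; omega,
    List.range_add, List.filter_append, List.filter_eq_nil_iff.2 (by simp),
    List.filter_eq_self.2 (by simp; omega), List.nil_append]
  refine List.ext_getElem? fun i => ?_
  rcases lt_or_ge i w₂.length with h | h
  · simp [h, Nat.add_assoc, Nat.add_comm 1]
  · simp [h]

theorem pairwise_lt_range_filter (n : ℕ) (f : ℕ → Bool) :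
    ((List.range n).filter f).Pairwise (· < ·) :=
  (List.pairwise_lt_range).sublist List.filter_sublist

end PosWord

namespace WeightedAutomaton

variable {Q : Type u} {α : Type v} {R : Type w} (A : WeightedAutomaton Q α R)

-- Lying left or right of the pebble is quantifier-free, so the prefixes, and likewise the suffixes,
-- are equivalent for the same number of rounds and have equal reachability maps. New runs on both
-- sides are then glued to the unchanged transition `δ`, whose letter the pebble preserves.
open PosWord in
theorem exists_run_of_EF [Finite Q] (hA : A.Aperiodic) {p q : Q} {ρ₁ ρ₂ : List A.trans}
    {δ : A.trans} (hρ : A.IsRun p (ρ₁ ++ δ :: ρ₂) q) {v₁ v₂ : List α} {b : α}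
    (h : EF (ofList ((ρ₁ ++ δ :: ρ₂).map A.letter)) (ofList (v₁ ++ b :: v₂))
      (roundBound (Nat.card Q)) [(ρ₁.length, v₁.length)]) :
    ∃ ρ₁' ρ₂', A.IsRun p (ρ₁' ++ δ :: ρ₂') q ∧ ρ₁'.map A.letter = v₁ ∧ A.letter δ = b ∧
      ρ₂'.map A.letter = v₂ := by
  rw [List.map_append, List.map_cons] at h
  obtain ⟨w₁, hw₁⟩ : ∃ w, ρ₁.map A.letter = w := ⟨_, rfl⟩
  obtain ⟨w₂, hw₂⟩ : ∃ w, ρ₂.map A.letter = w := ⟨_, rfl⟩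
  obtain ⟨r, hr₁, hr₂, hr₃⟩ := A.isRun_append.1 hρ
  have hlen : ρ₁.length = w₁.length := by rw [← hw₁, List.length_map]
  rw [hw₁, hw₂, hlen] at h
  have hδ : A.letter δ = b := by
    simpa [ofList] using h.compat.1 _ List.mem_cons_self
  have h₁ : A.reach w₁ = A.reach v₁ := by
    refine A.reach_eq_of_EF hA (pairwise_lt_range_filter _ _) (pairwise_lt_range_filter _ _)
      (range_filter_lt w₁ w₂ (A.letter δ)) (range_filter_lt v₁ v₂ b) ?_
    refine EF.filter h fun i _ j _ hij => ?_
    rw [decide_eq_decide]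
    exact lt_iff_of_compat hij (by simp) (by simp)
  have h₂ : A.reach w₂ = A.reach v₂ := by
    refine A.reach_eq_of_EF hA (pairwise_lt_range_filter _ _) (pairwise_lt_range_filter _ _)
      (range_filter_gt w₁ w₂ (A.letter δ)) (range_filter_gt v₁ v₂ b) ?_
    refine EF.filter h fun i _ j _ hij => ?_
    rw [decide_eq_decide]
    exact lt_iff_of_compat hij (by simp) (by simp)
  have g₁ : v₁ ∈ A.lang p r := by
    rw [← mem_reach_singleton, ← h₁, mem_reach_singleton]
    exact ⟨ρ₁, hr₁, hw₁⟩
  have g₂ : v₂ ∈ A.lang (A.tgt δ) q := by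
    rw [← mem_reach_singleton, ← h₂, mem_reach_singleton]
    exact ⟨ρ₂, hr₃, hw₂⟩
  obtain ⟨ρ₁', hr₁', hv₁⟩ := g₁
  obtain ⟨ρ₂', hr₂', hv₂⟩ := g₂
  exact ⟨ρ₁', ρ₂', A.isRun_append.2 ⟨r, hr₁', hr₂, hr₂'⟩, hv₁, hδ, hv₂⟩

end WeightedAutomaton

/-! ### Hintikka formulas -/

namespace FO

variable {α : Type v}

def conj (l : List (FO α)) : FO α := l.foldr .and .top

def disj (l : List (FO α)) : FO α := .neg (conj (l.map .neg))

def ex (x : ℕ) (φ : FO α) : FO α := .neg (.all x (.neg φ))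

theorem sat_conj {u : List α} {l : List (FO α)} {σ : ℕ → Fin u.length} :
    (conj l).Sat u σ ↔ ∀ φ ∈ l, φ.Sat u σ := by
  induction l with
  | nil => simp [conj, Sat]
  | cons φ l ih =>
    rw [List.forall_mem_cons, ← ih]
    rfl

theorem sat_disj {u : List α} {l : List (FO α)} {σ : ℕ → Fin u.length} :
    (disj l).Sat u σ ↔ ∃ φ ∈ l, φ.Sat u σ := by
  simp [disj, Sat, sat_conj]

theorem sat_ex {u : List α} {x : ℕ} {φ : FO α} {σ : ℕ → Fin u.length} :
    (ex x φ).Sat u σ ↔ ∃ i, φ.Sat u (Function.update σ x i) := by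
  simp [ex, Sat]

theorem freeVars_conj_subset {l : List (FO α)} {s : Finset ℕ} (h : ∀ φ ∈ l, φ.freeVars ⊆ s) :
    (conj l).freeVars ⊆ s := by
  induction l with
  | nil => simp [conj, freeVars]
  | cons φ l ih =>
    exact Finset.union_subset (h φ List.mem_cons_self)
      (ih fun ψ hψ => h ψ (List.mem_cons_of_mem _ hψ))

theorem freeVars_disj_subset {l : List (FO α)} {s : Finset ℕ} (h : ∀ φ ∈ l, φ.freeVars ⊆ s) :
    (disj l).freeVars ⊆ s := by
  refine freeVars_conj_subset (l := l.map .neg) fun φ hφ => ?_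
  obtain ⟨ψ, hψ, rfl⟩ := List.mem_map.1 hφ
  exact h ψ hψ

/-- The letter of `w` at position `x.2` is the letter at the variable `x.1`. -/
def letterAtom (w : List α) (x : ℕ × ℕ) : FO α :=
  (w[x.2]?).elim (.neg .top) fun a => .letter a x.1

/-- The variables `x.1`, `y.1` are ordered like the positions `x.2`, `y.2`. -/
def orderAtom (x y : ℕ × ℕ) : FO α :=
  if x.2 ≤ y.2 then .le x.1 y.1 else .neg (.le x.1 y.1)

/-- The atomic type of the positions `x.2` of `w`, named by the variables `x.1`, for `x ∈ p`. -/
def atomicType (w : List α) (p : List (ℕ × ℕ)) : FO α :=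
  .and (conj (p.map (letterAtom w))) (conj (p.flatMap fun x => p.map (orderAtom x)))

/-- The formula that describes `w` with the positions `x.2` named by the variables `x.1`, `x ∈ p`,
up to `k`-round equivalence. -/
def hintikka (w : List α) : ℕ → List (ℕ × ℕ) → FO α
  | 0, p => atomicType w p
  | k + 1, p => .and (atomicType w p)
      (.and (conj ((List.range w.length).map fun i =>
          ex p.length (hintikka w k ((p.length, i) :: p))))
        (.all p.length (disj ((List.range w.length).map fun i =>
          hintikka w k ((p.length, i) :: p)))))

open PosWord

theorem sat_atomicType {w v : List α} {p : List (ℕ × ℕ)} {σ : ℕ → Fin v.length} :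
    (atomicType w p).Sat v σ ↔
      Compat (ofList w) (ofList v) (p.map fun x => (x.2, (σ x.1 : ℕ))) := by
  rw [atomicType, Sat, sat_conj, sat_conj, Compat]
  refine and_congr ?_ ?_
  · simp only [List.forall_mem_map]
    refine forall₂_congr fun x _ => ?_
    rw [letterAtom]
    simp only [ofList, List.getElem?_eq_getElem (σ x.1).2]
    -- A position outside `w` has label `none`, which no position of `v` carries, so the atom is
    -- false there.
    cases w[x.2]? with
    | none => simp [Sat]
    | some a => simp [Sat, eq_comm]
  · simp only [List.forall_mem_map, List.mem_flatMap, forall_exists_index, and_imp]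
    rw [forall_comm]
    constructor
    · intro h x hx y hy
      have := h x _ hx (List.mem_map_of_mem hy)
      rw [orderAtom] at this
      split_ifs at this with hxy
      · exact iff_of_true hxy this
      · exact iff_of_false hxy this
    · intro h x φ hx hφ
      obtain ⟨y, hy, rfl⟩ := List.mem_map.1 hφ
      have := h x hx y hy
      rw [orderAtom]
      split_ifs with hxy
      · exact this.1 hxy
      · exact fun h => hxy (this.2 h)

/-- The conjunction of existentials covers Spoiler's moves in `w`, the universal disjunction those
in `v`. The hypothesis makes the variable `p.length` fresh, so quantifying it leaves the earlier
pebbles in place. -/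
theorem sat_hintikka {w v : List α} {k : ℕ} {p : List (ℕ × ℕ)}
    (hp : ∀ x ∈ p, x.1 < p.length) {σ : ℕ → Fin v.length} :
    (hintikka w k p).Sat v σ ↔
      EF (ofList w) (ofList v) k (p.map fun x => (x.2, (σ x.1 : ℕ))) := by
  induction k generalizing p σ with
  | zero => exact sat_atomicType
  | succ k ih =>
    have key : ∀ i j, (hintikka w k ((p.length, i) :: p)).Sat v (Function.update σ p.length j) ↔
        EF (ofList w) (ofList v) k ((i, (j : ℕ)) :: p.map fun x => (x.2, (σ x.1 : ℕ))) := by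
      intro i j
      rw [ih (by
        simp only [List.mem_cons, List.length_cons, forall_eq_or_imp]
        exact ⟨Nat.lt_succ_self _, fun x hx => (hp x hx).trans (Nat.lt_succ_self _)⟩)]
      rw [List.map_cons, Function.update_self]
      refine iff_of_eq (congrArg _ (congrArg _ (List.map_congr_left fun x hx => ?_)))
      rw [Function.update_of_ne (hp x hx).ne]
    rw [hintikka, Sat, Sat, sat_atomicType, sat_conj, EF]
    refine and_congr_right fun _ => and_congr ?_ ?_
    · simp only [List.forall_mem_map, sat_ex, key]
      refine forall₂_congr fun i _ => ?_
      simp only [ofList, List.mem_range]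
      exact ⟨fun ⟨j, h⟩ => ⟨j, j.2, h⟩, fun ⟨j, hj, h⟩ => ⟨⟨j, hj⟩, h⟩⟩
    · simp only [Sat, sat_disj, List.mem_map, exists_exists_and_eq_and, key]
      simp only [ofList, List.mem_range]
      exact ⟨fun h j hj => h ⟨j, hj⟩, fun h j => h j j.2⟩

theorem freeVars_hintikka {w : List α} {k : ℕ} {p : List (ℕ × ℕ)}
    (hp : ∀ x ∈ p, x.1 < p.length) : (hintikka w k p).freeVars ⊆ Finset.range p.length := by
  have hat : ∀ {p : List (ℕ × ℕ)}, (∀ x ∈ p, x.1 < p.length) →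
      (atomicType w p).freeVars ⊆ Finset.range p.length := by
    intro p hp
    refine Finset.union_subset (freeVars_conj_subset fun φ hφ => ?_)
      (freeVars_conj_subset fun φ hφ => ?_)
    · obtain ⟨x, hx, rfl⟩ := List.mem_map.1 hφ
      rw [letterAtom]
      cases w[x.2]? with
      | none => simp [freeVars]
      | some a => simpa [freeVars] using hp x hx
    · obtain ⟨x, hx, hφ⟩ := List.mem_flatMap.1 hφ
      obtain ⟨y, hy, rfl⟩ := List.mem_map.1 hφ
      rw [orderAtom]
      split_ifs <;> simp [freeVars, Finset.insert_subset_iff, hp x hx, hp y hy]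
  induction k generalizing p with
  | zero => exact hat hp
  | succ k ih =>
    have key : ∀ i, (hintikka w k ((p.length, i) :: p)).freeVars.erase p.length ⊆
        Finset.range p.length := by
      intro i
      have := ih (p := (p.length, i) :: p) (by
        simp only [List.mem_cons, List.length_cons, forall_eq_or_imp]
        exact ⟨Nat.lt_succ_self _, fun x hx => (hp x hx).trans (Nat.lt_succ_self _)⟩)
      rw [List.length_cons, Finset.range_add_one] at this
      exact Finset.subset_insert_iff.1 this
    refine Finset.union_subset (hat hp) (Finset.union_subset ?_ ?_)
    · refine freeVars_conj_subset fun φ hφ => ?_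
      obtain ⟨i, -, rfl⟩ := List.mem_map.1 hφ
      exact key i
    · rw [freeVars, ← Finset.subset_insert_iff]
      refine freeVars_disj_subset fun φ hφ => ?_
      obtain ⟨i, -, rfl⟩ := List.mem_map.1 hφ
      exact Finset.subset_insert_iff.2 (key i)

end FO

end WFOLogic

/-! ### Short representatives of marked words -/

namespace WFOLogic

namespace PosWord

variable {α : Type v}

theorem exists_map_some {l : List ℕ} {v : List α} (h : ∀ i ∈ l, i < v.length) :
    ∃ w : List α, l.map (fun i => v[i]?) = w.map some := by
  induction l with
  | nil => exact ⟨[], rfl⟩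
  | cons i l ih =>
    obtain ⟨w, hw⟩ := ih fun j hj => h j (List.mem_cons_of_mem _ hj)
    exact ⟨v[i]'(h i List.mem_cons_self) :: w, by simp [hw, h i List.mem_cons_self]⟩

/-- A word on arbitrary positions is equivalent to the list of its letters. -/
theorem EF.ofList_of_map {E : List ℕ} {lab : ℕ → Option α} {w : List α}
    (hE : E.Pairwise (· < ·)) (h : E.map lab = w.map some) (k : ℕ) {p : List (ℕ × ℕ)}
    (hp : ∀ x ∈ p, E[x.2]? = some x.1) : EF ⟨E, lab⟩ (ofList w) k p := by
  have hlen : E.length = w.length := by simpa using congrArg List.length h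
  refine EF.of_map (e := E.zipIdx) ⟨?_, ?_⟩ (by simp) ?_ k fun x hx => ?_
  · rintro ⟨x, n⟩ hx
    have hx := List.mem_zipIdx_iff_getElem?.1 hx
    have := congrArg (fun l => l[n]?) h
    simp only at hx
    simp only [List.getElem?_map, hx, Option.map_some] at this
    obtain ⟨a, ha, ha'⟩ := Option.map_eq_some_iff.1 this.symm
    simp [ofList, ha, ← ha']
  · rintro ⟨x, n⟩ hx ⟨y, m⟩ hy
    have hx : E[n]? = some x := List.mem_zipIdx_iff_getElem?.1 hx
    have hy : E[m]? = some y := List.mem_zipIdx_iff_getElem?.1 hy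
    obtain ⟨hn, rfl⟩ := List.getElem?_eq_some_iff.1 hx
    obtain ⟨hm, rfl⟩ := List.getElem?_eq_some_iff.1 hy
    have := List.pairwise_iff_getElem.1 hE
    rcases lt_trichotomy n m with hnm | rfl | hnm
    · exact iff_of_true (this _ _ hn hm hnm).le hnm.le
    · simp
    · exact iff_of_false (this _ _ hm hn hnm).not_ge hnm.not_ge
  · rw [List.zipIdx_map_snd, hlen, ofList, List.range_eq_range']
  · exact List.mem_zipIdx_iff_getElem?.2 (hp x hx)

/-- Every word with a distinguished position, over `a` letters, is equivalent to one of at most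
this length. -/
def lengthBound (a k : ℕ) : ℕ := 2 * numClasses (a + 1) k 0 + 1

/-- The two sides of the marked position are shortened independently and put together by congruence,
hence twice the class bound plus one. Labels lie in `Option α`, hence one extra letter in the bound.
-/
theorem exists_short_word [Finite α] (k : ℕ) (v₁ : List α) (b : α) (v₂ : List α) :
    ∃ w₁ w₂ : List α, (w₁ ++ b :: w₂).length ≤ lengthBound (Nat.card α) k ∧
      EF (ofList (v₁ ++ b :: v₂)) (ofList (w₁ ++ b :: w₂)) k [(v₁.length, w₁.length)] := by
  have := Fintype.ofFinite α
  have hcard : Fintype.card (Option α) = Nat.card α + 1 := by simp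
  set lab : ℕ → Option α := fun i => (v₁ ++ b :: v₂)[i]? with hlab
  have hsplit : List.range (v₁ ++ b :: v₂).length =
      List.range v₁.length ++ ([v₁.length] ++ List.range' (v₁.length + 1) v₂.length) := by
    rw [List.length_append, List.length_cons, List.range_add, List.singleton_append,
      ← List.range'_succ, List.range_eq_range' (n := v₂.length + 1), List.map_add_range',
      Nat.add_zero]
  obtain ⟨E₁, hE₁, hl₁, h₁⟩ := exists_short_sublist lab k (List.range v₁.length)
    List.pairwise_lt_range
  obtain ⟨E₂, hE₂, hl₂, h₂⟩ := exists_short_sublist lab k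
    (List.range' (v₁.length + 1) v₂.length) (List.pairwise_lt_range' (step := 1))
  rw [hcard] at hl₁ hl₂
  have hD₁ : ∀ i ∈ List.range v₁.length, i < v₁.length := fun i hi => List.mem_range.1 hi
  have hD₂ : ∀ i ∈ List.range' (v₁.length + 1) v₂.length,
      v₁.length < i ∧ i < (v₁ ++ b :: v₂).length := by
    intro i hi
    rw [List.mem_range'_1] at hi
    simp only [List.length_append, List.length_cons]
    omega
  have hmid : EF ⟨[v₁.length] ++ List.range' (v₁.length + 1) v₂.length, lab⟩
      ⟨[v₁.length] ++ E₂, lab⟩ k [(v₁.length, v₁.length)] := by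
    refine EF.append (p₁ := [(v₁.length, v₁.length)]) (p₂ := []) ?_ ?_ (by simp) (by simp)
      (EF.refl _ _ (by simp)) h₂ (by simp)
    · simpa using fun i hi => (hD₂ i hi).1
    · simpa using fun i hi => (hD₂ i (hE₂.subset hi)).1
  have hall : EF ⟨List.range (v₁ ++ b :: v₂).length, lab⟩ ⟨E₁ ++ ([v₁.length] ++ E₂), lab⟩ k
      [(v₁.length, v₁.length)] := by
    rw [hsplit]
    refine EF.append (p₁ := []) (p₂ := [(v₁.length, v₁.length)]) ?_ ?_ (by simp) (by simp)
      h₁ hmid (by simp)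
    · intro i hi j hj
      have := hD₁ i hi
      rcases List.mem_append.1 hj with hj | hj
      · rwa [List.mem_singleton.1 hj]
      · exact this.trans (hD₂ j hj).1
    · intro i hi j hj
      have := hD₁ i (hE₁.subset hi)
      rcases List.mem_append.1 hj with hj | hj
      · rwa [List.mem_singleton.1 hj]
      · exact this.trans (hD₂ j (hE₂.subset hj)).1
  obtain ⟨w₁, hw₁⟩ := exists_map_some (l := E₁) (v := v₁ ++ b :: v₂) fun i hi => by
    have := hD₁ i (hE₁.subset hi)
    simp only [List.length_append, List.length_cons]
    omega
  obtain ⟨w₂, hw₂⟩ := exists_map_some (l := E₂) (v := v₁ ++ b :: v₂) fun i hi =>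
    (hD₂ i (hE₂.subset hi)).2
  have hlen₁ : E₁.length = w₁.length := by simpa using congrArg List.length hw₁
  have hlen₂ : E₂.length = w₂.length := by simpa using congrArg List.length hw₂
  refine ⟨w₁, w₂, ?_, ?_⟩
  · simp only [List.length_append, List.length_cons, lengthBound]
    omega
  · refine EF.trans (v := ⟨E₁ ++ ([v₁.length] ++ E₂), lab⟩)
      (l := [(v₁.length, v₁.length, w₁.length)]) hall (EF.ofList_of_map ?_ ?_ k ?_)
    · have : (E₁ ++ ([v₁.length] ++ E₂)).Sublist (List.range (v₁ ++ b :: v₂).length) := by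
        rw [hsplit]
        exact hE₁.append ((List.Sublist.refl _).append hE₂)
      exact List.pairwise_lt_range.sublist this
    · rw [List.map_append, List.map_append, hw₁, hw₂]
      simp [hlab]
    · simp [hlen₁]

end PosWord

/-! ### The sentence of an automaton -/

section Sentence

variable {α : Type v} {R : Type w}

open FO PosWord

/-- The formula with free variable `0` that describes the word `m.1` with distinguished
position `m.2.1`. -/
def markFormula (k : ℕ) (m : List α × ℕ × R) : FO α := hintikka m.1 k [(0, m.2.1)]

/-- For a nonempty word and the marking used below, one matching position already yields a run on
the whole word, and a run makes every position match; so the universal quantifier loses nothing. -/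
def condFormula (k : ℕ) (L : List (List α × ℕ × R)) : FO α :=
  .all 0 (disj (L.map (markFormula k)))

/-- The final test has equal branches and does not affect the value; it keeps the variable `0` free
even if `L` is empty. The default weight `r` is never used when some mark matches. -/
def stepFormula (k : ℕ) (L : List (List α × ℕ × R)) (r : R) : StepWFO α R :=
  L.foldr (fun m Ψ => .ite (markFormula k m) (.const m.2.2) Ψ)
    (.ite (.le 0 0) (.const r) (.const r))

def sentence (k : ℕ) (L : List (List α × ℕ × R)) (r : R) : WFO α R :=
  .ite (condFormula k L) (.prod 0 (stepFormula k L r)) .zero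

theorem freeVars_markFormula (k : ℕ) (m : List α × ℕ × R) : (markFormula k m).freeVars ⊆ {0} :=
  freeVars_hintikka (p := [(0, m.2.1)]) (by simp)

theorem sat_markFormula {k : ℕ} {m : List α × ℕ × R} {u : List α} {σ : ℕ → Fin u.length} :
    (markFormula k m).Sat u σ ↔ EF (ofList m.1) (ofList u) k [(m.2.1, (σ 0 : ℕ))] :=
  sat_hintikka (p := [(0, m.2.1)]) (by simp)

theorem freeVars_condFormula (k : ℕ) (L : List (List α × ℕ × R)) :
    (condFormula k L).freeVars = ∅ := by
  rw [condFormula, FO.freeVars, ← Finset.subset_empty, ← Finset.subset_insert_iff]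
  refine freeVars_disj_subset fun φ hφ => ?_
  obtain ⟨m, -, rfl⟩ := List.mem_map.1 hφ
  exact freeVars_markFormula k m

theorem freeVars_stepFormula (k : ℕ) (L : List (List α × ℕ × R)) (r : R) :
    (stepFormula k L r).freeVars = {0} := by
  induction L with
  | nil => simp [stepFormula, StepWFO.freeVars, FO.freeVars]
  | cons m L ih =>
    rw [stepFormula, List.foldr_cons, ← stepFormula, StepWFO.freeVars, ih]
    rw [StepWFO.freeVars, Finset.union_empty]
    exact Finset.union_eq_right.2 (freeVars_markFormula k m)

theorem freeVars_sentence (k : ℕ) (L : List (List α × ℕ × R)) (r : R) :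
    (sentence k L r).freeVars = ∅ := by
  simp [sentence, WFO.freeVars, freeVars_condFormula, freeVars_stepFormula]

theorem sem_stepFormula {k : ℕ} {L : List (List α × ℕ × R)} {r s : R} {u : List α}
    {σ : ℕ → Fin u.length} (h : ∃ m ∈ L, (markFormula k m).Sat u σ)
    (hs : ∀ m ∈ L, (markFormula k m).Sat u σ → m.2.2 = s) : (stepFormula k L r).sem u σ = s := by
  induction L with
  | nil => simp at h
  | cons m L ih =>
    rw [stepFormula, List.foldr_cons, ← stepFormula, StepWFO.sem]
    split_ifs with hm
    · exact hs m List.mem_cons_self hm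
    · refine ih ?_ fun n hn => hs n (List.mem_cons_of_mem _ hn)
      obtain ⟨n, hn, h⟩ := h
      rcases List.mem_cons.1 hn with rfl | hn
      · exact absurd h hm
      · exact ⟨n, hn, h⟩

end Sentence

namespace WeightedAutomaton

open FO PosWord

variable {Q : Type u} {α : Type v} {R : Type w} (A : WeightedAutomaton Q α R)

/-- `L` lists the labels of the runs from `p` to `q` of length at most `b`, with a distinguished
position and the weight of the transition at this position. -/
structure IsMarking (p q : Q) (b : ℕ) (L : List (List α × ℕ × R)) : Prop where
  sound : ∀ m ∈ L, ∃ ρ₁ δ ρ₂, A.IsRun p (ρ₁ ++ δ :: ρ₂) q ∧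
    m = ((ρ₁ ++ δ :: ρ₂).map A.letter, ρ₁.length, A.wgt δ)
  complete : ∀ ρ₁ δ ρ₂, A.IsRun p (ρ₁ ++ δ :: ρ₂) q → (ρ₁ ++ δ :: ρ₂).length ≤ b →
    ((ρ₁ ++ δ :: ρ₂).map A.letter, ρ₁.length, A.wgt δ) ∈ L

variable {A} in
theorem absSem_eq_singleton [Finite Q] [Finite α] {p q : Q} (hU : A.UnambiguousFromTo p q)
    {u : List α} (hu : u ≠ []) {ρ : List A.trans} (hρ : ρ ∈ A.runs p q u) :
    A.absSem p q u = {ρ.map A.wgt} := by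
  have : (A.finite_runs p q u).toFinset = {ρ} := by
    ext ρ'
    rw [Set.Finite.mem_toFinset, Finset.mem_singleton]
    exact ⟨fun h => hU u hu h hρ, fun h => h ▸ hρ⟩
  rw [absSem, this]
  rfl

-- A match at position `i` lifts to a run on `u` with the recorded transition at `i` (`hrun`).
-- Conversely, a run on `u` marked at `i` is carried to a short equivalent marked word, which the
-- list contains (`hmark`). Unambiguity makes all runs obtained from matches equal, so the matching
-- marks at `i` agree on the weight.
variable {A} in
theorem absSem_eq_sentence [Finite Q] [Finite α] (hA : A.Aperiodic) {p q : Q}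
    (hU : A.UnambiguousFromTo p q) {k : ℕ} (hk : k = roundBound (Nat.card Q))
    {L : List (List α × ℕ × R)} (hL : A.IsMarking p q (lengthBound (Nat.card α) k) L) (r : R)
    {u : List α} (hu : u ≠ []) (σ : ℕ → Fin u.length) :
    A.absSem p q u = (sentence k L r).absSem u σ := by
  classical
  have hsplit : ∀ i : Fin u.length, ∃ u₁ b u₂, u = u₁ ++ b :: u₂ ∧ u₁.length = (i : ℕ) := by
    intro i
    refine ⟨u.take i, u[i], u.drop (i + 1), ?_, by simp [i.2.le]⟩
    rw [Fin.getElem_fin, List.getElem_cons_drop, List.take_append_drop]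
  have hrun : ∀ (i : Fin u.length) (m), m ∈ L →
      (markFormula k m).Sat u (Function.update σ 0 i) →
      ∃ ρ₁ δ ρ₂, ρ₁ ++ δ :: ρ₂ ∈ A.runs p q u ∧ ρ₁.length = (i : ℕ) ∧ m.2.2 = A.wgt δ := by
    intro i m hm hsat
    rw [sat_markFormula, Function.update_self] at hsat
    obtain ⟨ρ₁, δ, ρ₂, hρ, rfl⟩ := hL.sound m hm
    obtain ⟨u₁, b, u₂, rfl, hi⟩ := hsplit i
    simp only [← hi, hk] at hsat
    obtain ⟨ρ₁', ρ₂', hρ', h₁, h₂, h₃⟩ := A.exists_run_of_EF hA hρ hsat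
    exact ⟨ρ₁', δ, ρ₂', ⟨hρ', by simp [h₁, h₂, h₃]⟩, by rw [← hi, ← h₁, List.length_map], rfl⟩
  have hmark : ∀ ρ ∈ A.runs p q u, ∀ i : Fin u.length,
      ∃ m ∈ L, (markFormula k m).Sat u (Function.update σ 0 i) := by
    rintro ρ ⟨hρ, hlab⟩ i
    obtain ⟨u₁, b, u₂, rfl, hi⟩ := hsplit i
    obtain ⟨ρ₁, ρ', rfl, h₁, h'⟩ := List.map_eq_append_iff.1 hlab
    obtain ⟨δ, ρ₂, rfl, h₂, h₃⟩ := List.map_eq_cons_iff.1 h'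
    obtain ⟨w₁, w₂, hlen, hEF⟩ := exists_short_word k u₁ b u₂
    have hlen₁ : u₁.length = ρ₁.length := by rw [← h₁, List.length_map]
    have hEF' := hEF
    rw [hlen₁, ← hlab, hk] at hEF'
    obtain ⟨ρ₁', ρ₂', hρ', h₁', h₂', h₃'⟩ := A.exists_run_of_EF hA hρ hEF'
    have hw : (ρ₁' ++ δ :: ρ₂').map A.letter = w₁ ++ b :: w₂ := by simp [h₁', h₂', h₃']
    refine ⟨_, hL.complete ρ₁' δ ρ₂' hρ' ?_, ?_⟩
    · rw [← hw, List.length_map] at hlen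
      exact hlen
    · rw [sat_markFormula, Function.update_self, hw, ← hi]
      simpa [← h₁'] using hEF.symm
  rw [sentence, WFO.absSem]
  by_cases hex : ∃ ρ, ρ ∈ A.runs p q u
  · obtain ⟨ρ, hρ⟩ := hex
    rw [if_pos, absSem_eq_singleton hU hu hρ, WFO.absSem]
    · congr 1
      have hlen : ρ.length = u.length := by rw [← hρ.2, List.length_map]
      refine List.ext_getElem (by simp [hlen]) fun i h₁ h₂ => ?_
      rw [List.getElem_ofFn, List.getElem_map]
      refine (sem_stepFormula (hmark ρ hρ _) fun m hm hsat => ?_).symm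
      obtain ⟨ρ₁, δ, ρ₂, h, hi, hδ⟩ := hrun _ m hm hsat
      have := hU u hu hρ h
      subst this
      simp only at hi
      subst hi
      simpa using hδ
    · intro i
      rw [sat_disj]
      obtain ⟨m, hm, h⟩ := hmark ρ hρ i
      exact ⟨_, List.mem_map_of_mem hm, h⟩
  · have hemp : (A.finite_runs p q u).toFinset = ∅ := by
      ext ρ
      simpa using fun h => hex ⟨ρ, h⟩
    rw [if_neg, absSem, hemp]
    · rfl
    · intro h
      have := h ⟨0, List.length_pos_iff.2 hu⟩
      rw [sat_disj] at this
      obtain ⟨φ, hφ, hsat⟩ := this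
      obtain ⟨m, hm, rfl⟩ := List.mem_map.1 hφ
      obtain ⟨ρ₁, δ, ρ₂, h, -, -⟩ := hrun _ m hm hsat
      exact hex ⟨_, h⟩

end WeightedAutomaton
end WFOLogic

namespace WFOLogic

/-! ### Listing the marked runs -/

/-- All lists of length at most `n` over `T`. -/
def listsUpTo {τ : Type*} (T : List τ) : ℕ → List (List τ)
  | 0 => [[]]
  | n + 1 => [] :: (listsUpTo T n).flatMap fun l => T.map fun t => t :: l

theorem mem_listsUpTo {τ : Type*} {T : List τ} {n : ℕ} {l : List τ} :
    l ∈ listsUpTo T n ↔ l.length ≤ n ∧ ∀ t ∈ l, t ∈ T := by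
  induction n generalizing l with
  | zero => cases l <;> simp [listsUpTo]
  | succ n ih =>
    cases l with
    | nil => simp [listsUpTo]
    | cons t l =>
      simp only [listsUpTo, List.mem_cons, reduceCtorEq, List.mem_flatMap, List.mem_map, ih,
        false_or, List.length_cons, Nat.add_le_add_iff_right, forall_eq_or_imp]
      constructor
      · rintro ⟨l', ⟨h₁, h₂⟩, t', ht, h⟩
        obtain ⟨rfl, rfl⟩ := List.cons.inj h
        exact ⟨h₁, ht, h₂⟩
      · rintro ⟨h₁, ht, h₂⟩
        exact ⟨l, ⟨h₁, h₂⟩, t, ht, rfl⟩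

theorem listsUpTo_map {τ τ' : Type*} (f : τ → τ') (T : List τ) (n : ℕ) :
    listsUpTo (T.map f) n = (listsUpTo T n).map (List.map f) := by
  induction n with
  | zero => rfl
  | succ n ih =>
    simp [listsUpTo, ih, List.flatMap_map, List.map_flatMap, Function.comp_def]

section Marking

variable {Q : Type u} {α : Type v} {R : Type w}

/-- The state reached from `p` by a list of weighted transitions, if it is a run. -/
def runEnd [DecidableEq Q] (p : Q) (l : List (Q × α × Q × R)) : Option Q :=
  l.foldl (fun s t => if s = some t.1 then some t.2.2.1 else none) (some p)

/-- The label of a list of weighted transitions with a distinguished position and the weight at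
this position, for all positions. -/
def marks (l : List (Q × α × Q × R)) : List (List α × ℕ × R) :=
  (List.range l.length).flatMap fun j =>
    (l[j]?.map fun t => (l.map fun t => t.2.1, j, t.2.2.2)).toList

def marking [DecidableEq Q] (p q : Q) (b : ℕ) (T : List (Q × α × Q × R)) :
    List (List α × ℕ × R) :=
  (listsUpTo T b).flatMap fun l => if runEnd p l = some q then marks l else []

theorem mem_marks {l : List (Q × α × Q × R)} {m : List α × ℕ × R} :
    m ∈ marks l ↔ ∃ l₁ t l₂, l = l₁ ++ t :: l₂ ∧
      m = (l.map fun t => t.2.1, l₁.length, t.2.2.2) := by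
  simp only [marks, List.mem_flatMap, List.mem_range, Option.mem_toList,
    Option.map_eq_some_iff]
  constructor
  · rintro ⟨j, hj, t, ht, rfl⟩
    obtain ⟨_, rfl⟩ := List.getElem?_eq_some_iff.1 ht
    refine ⟨l.take j, l[j], l.drop (j + 1), ?_, by simp [hj.le]⟩
    rw [List.getElem_cons_drop, List.take_append_drop]
  · rintro ⟨l₁, t, l₂, rfl, rfl⟩
    exact ⟨l₁.length, by simp, t, by simp, rfl⟩

theorem foldl_runEnd_none [DecidableEq Q] (l : List (Q × α × Q × R)) :
    l.foldl (fun s t => if s = some t.1 then some t.2.2.1 else none) none = none := by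
  induction l with
  | nil => rfl
  | cons t l ih => simpa using ih

theorem runEnd_cons [DecidableEq Q] (p : Q) (t : Q × α × Q × R) (l : List (Q × α × Q × R)) :
    runEnd p (t :: l) = if t.1 = p then runEnd t.2.2.1 l else none := by
  rw [runEnd, List.foldl_cons]
  by_cases h : t.1 = p
  · rw [if_pos h, if_pos (by rw [h])]; rfl
  · rw [if_neg h, if_neg fun h' => h (Option.some.inj h').symm]
    exact foldl_runEnd_none l

/-- Renaming states and letters. -/
def mapTransition {Q' : Type*} {α' : Type*} (f : Q → Q') (g : α → α') (t : Q × α × Q × R) :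
    Q' × α' × Q' × R :=
  (f t.1, g t.2.1, f t.2.2.1, t.2.2.2)

theorem marks_map {Q' : Type*} {α' : Type*} (f : Q → Q') (g : α → α')
    (l : List (Q × α × Q × R)) :
    marks (l.map (mapTransition f g)) = (marks l).map fun m => (m.1.map g, m.2) := by
  rw [marks, marks, List.map_flatMap, List.length_map]
  refine congrArg₂ _ (funext fun j => ?_) rfl
  rw [List.getElem?_map]
  cases l[j]? with
  | none => rfl
  | some t => simp [mapTransition, Function.comp_def]

theorem runEnd_map [DecidableEq Q] {Q' : Type*} [DecidableEq Q'] {α' : Type*} {f : Q → Q'}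
    (hf : Function.Injective f) (g : α → α') (p : Q) (l : List (Q × α × Q × R)) :
    runEnd (f p) (l.map (mapTransition f g)) = (runEnd p l).map f := by
  induction l generalizing p with
  | nil => rfl
  | cons t l ih =>
    rw [List.map_cons, runEnd_cons, runEnd_cons]
    by_cases h : t.1 = p
    · rw [if_pos h]
      exact (if_pos (congrArg f h)).trans (ih _)
    · rw [if_neg h]
      exact if_neg fun h' => h (hf h')

/-- The algorithm works with numbers, the sentence with actual states and letters. Only states are
compared when checking runs, so only their renaming has to be injective. -/
theorem marking_map [DecidableEq Q] {Q' : Type*} [DecidableEq Q'] {α' : Type*} {f : Q → Q'}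
    (hf : Function.Injective f) (g : α → α') (p q : Q) (b : ℕ) (T : List (Q × α × Q × R)) :
    marking (f p) (f q) b (T.map (mapTransition f g)) =
      (marking p q b T).map fun m => (m.1.map g, m.2) := by
  rw [marking, marking, listsUpTo_map, List.flatMap_map, List.map_flatMap]
  refine congrArg₂ _ (funext fun l => ?_) rfl
  rw [runEnd_map hf]
  by_cases h : runEnd p l = some q
  · rw [if_pos h, if_pos (by rw [h]; rfl), marks_map]
  · rw [if_neg h, if_neg fun h' => h ?_, List.map_nil]
    obtain ⟨s, hs, hsq⟩ := Option.map_eq_some_iff.1 h'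
    rw [hs, hf hsq]

theorem exists_map_eq_of_forall_mem {τ τ' : Type*} {f : τ → τ'} {l : List τ'}
    (h : ∀ t ∈ l, ∃ s, f s = t) : ∃ l' : List τ, l'.map f = l := by
  induction l with
  | nil => exact ⟨[], rfl⟩
  | cons t l ih =>
    obtain ⟨l', rfl⟩ := ih fun s hs => h s (List.mem_cons_of_mem _ hs)
    obtain ⟨s, rfl⟩ := h t List.mem_cons_self
    exact ⟨s :: l', rfl⟩

namespace WeightedAutomaton

variable (A : WeightedAutomaton Q α R)

/-- A transition as a tuple (source, letter, target, weight). -/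
def tuple (δ : A.trans) : Q × α × Q × R := (A.src δ, A.letter δ, A.tgt δ, A.wgt δ)

theorem runEnd_eq_some_iff [DecidableEq Q] {p q : Q} {ρ : List A.trans} :
    runEnd p (ρ.map A.tuple) = some q ↔ A.IsRun p ρ q := by
  induction ρ generalizing p with
  | nil => simp [runEnd, IsRun]
  | cons δ ρ ih =>
    rw [List.map_cons, runEnd_cons, IsRun, ← ih]
    by_cases h : A.src δ = p <;> simp [tuple, h]

theorem isMarking_marking [DecidableEq Q] {T : List (Q × α × Q × R)}
    (hT : ∀ t, t ∈ T ↔ ∃ δ, A.tuple δ = t) (p q : Q) (b : ℕ) :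
    A.IsMarking p q b (marking p q b T) := by
  constructor
  · intro m hm
    obtain ⟨l, hl, hm⟩ := List.mem_flatMap.1 hm
    obtain ⟨ρ, rfl⟩ := exists_map_eq_of_forall_mem fun t ht =>
      (hT t).1 ((mem_listsUpTo.1 hl).2 t ht)
    split_ifs at hm with h
    · rw [runEnd_eq_some_iff] at h
      obtain ⟨l₁, t, l₂, hρ, rfl⟩ := mem_marks.1 hm
      obtain ⟨ρ₁, ρ', rfl, rfl, h'⟩ := List.map_eq_append_iff.1 hρ
      obtain ⟨δ, ρ₂, rfl, rfl, rfl⟩ := List.map_eq_cons_iff.1 h'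
      exact ⟨ρ₁, δ, ρ₂, h, by simp [tuple, Function.comp_def]⟩
    · simp at hm
  · intro ρ₁ δ ρ₂ h hlen
    refine List.mem_flatMap.2 ⟨(ρ₁ ++ δ :: ρ₂).map A.tuple, mem_listsUpTo.2 ⟨?_, ?_⟩, ?_⟩
    · simpa using hlen
    · simp only [List.forall_mem_map]
      exact fun δ _ => (hT _).2 ⟨δ, rfl⟩
    · rw [if_pos (A.runEnd_eq_some_iff.2 h), mem_marks]
      exact ⟨ρ₁.map A.tuple, A.tuple δ, ρ₂.map A.tuple, by simp, by
        simp [tuple, Function.comp_def]⟩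

end WeightedAutomaton

end Marking

/-! ### Computing the sentence -/

section Codes

open Encodable

theorem FO.code_conj {α : Type v} [Encodable α] (l : List (FO α)) :
    (FO.conj l).code = (l.map FO.code).foldr (fun a b => Nat.pair 4 (Nat.pair a b))
      (Nat.pair 0 0) := by
  induction l with
  | nil => rfl
  | cons φ l ih => rw [List.map_cons, List.foldr_cons, ← ih]; rfl

/-- The code of the conjunction of formulas with given codes. -/
def codeConj (l : List ℕ) : ℕ :=
  l.foldr (fun a b => Nat.pair 4 (Nat.pair a b)) (Nat.pair 0 0)

/-- The code of the disjunction of formulas with given codes. -/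
def codeDisj (l : List ℕ) : ℕ := Nat.pair 3 (codeConj (l.map (Nat.pair 3)))

def codeEx (x a : ℕ) : ℕ := Nat.pair 3 (Nat.pair 5 (Nat.pair x (Nat.pair 3 a)))

variable {α : Type v} [Encodable α] {R : Type w}

theorem FO.code_disj (l : List (FO α)) : (FO.disj l).code = codeDisj (l.map FO.code) := by
  rw [FO.disj, FO.code, FO.code_conj, codeDisj, codeConj, List.map_map, List.map_map]
  rfl

theorem FO.code_letterAtom_map (w : List α) (x : ℕ × ℕ) :
    (FO.letterAtom (w.map encode) x).code = (FO.letterAtom w x).code := by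
  rw [FO.letterAtom, FO.letterAtom, List.getElem?_map]
  cases w[x.2]? <;> rfl

theorem FO.code_orderAtom {β : Type*} [Encodable β] (x y : ℕ × ℕ) :
    (FO.orderAtom x y : FO β).code = if x.2 ≤ y.2 then Nat.pair 2 (Nat.pair x.1 y.1) else
      Nat.pair 3 (Nat.pair 2 (Nat.pair x.1 y.1)) := by
  rw [FO.orderAtom]
  split_ifs <;> rfl

theorem FO.code_atomicType (w : List α) (p : List (ℕ × ℕ)) :
    (FO.atomicType w p).code = Nat.pair 4 (Nat.pair
      (codeConj (p.map fun x => (FO.letterAtom w x).code))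
      (codeConj (p.flatMap fun x => p.map fun y => if x.2 ≤ y.2 then
        Nat.pair 2 (Nat.pair x.1 y.1) else Nat.pair 3 (Nat.pair 2 (Nat.pair x.1 y.1))))) := by
  rw [FO.atomicType, FO.code, FO.code_conj, FO.code_conj, List.map_map, List.map_flatMap]
  simp only [List.map_map, Function.comp_def, FO.code_orderAtom]
  rfl

/-- Both halves of the formula are assembled from one list `l` of recursive values, the shape needed
for computing the code by recursion. -/
theorem FO.code_hintikka_succ (w : List α) (k : ℕ) (p : List (ℕ × ℕ)) {l : List ℕ}
    (hl : l = (List.range w.length).map fun i =>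
      (FO.hintikka w k ((p.length, i) :: p)).code) :
    (FO.hintikka w (k + 1) p).code = Nat.pair 4 (Nat.pair (FO.atomicType w p).code
      (Nat.pair 4 (Nat.pair (codeConj (l.map (codeEx p.length)))
        (Nat.pair 5 (Nat.pair p.length (codeDisj l)))))) := by
  subst hl
  rw [FO.hintikka, FO.code, FO.code, FO.code_conj, FO.code, FO.code_disj, List.map_map,
    List.map_map, List.map_map]
  rfl

/-- Letters enter a code only through their own codes, so the code can be computed over the alphabet
`ℕ`. -/
theorem FO.code_hintikka_map (w : List α) (k : ℕ) (p : List (ℕ × ℕ)) :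
    (FO.hintikka (w.map encode) k p).code = (FO.hintikka w k p).code := by
  have hat : ∀ p, (FO.atomicType (w.map encode) p).code = (FO.atomicType w p).code := by
    intro p
    simp only [FO.code_atomicType, FO.code_letterAtom_map]
  induction k generalizing p with
  | zero => exact hat p
  | succ k ih =>
    rw [FO.code_hintikka_succ _ _ _ rfl, FO.code_hintikka_succ _ _ _ rfl, hat]
    simp only [ih, List.length_map]

variable [Encodable R]

theorem StepWFO.code_stepFormula (k : ℕ) (L : List (List α × ℕ × R)) (r : R) :
    (stepFormula k L r).code = L.foldr (fun m a => Nat.pair 1 (Nat.pair (markFormula k m).code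
      (Nat.pair (Nat.pair 0 (encode m.2.2)) a)))
      (Nat.pair 1 (Nat.pair (Nat.pair 2 (Nat.pair 0 0)) (Nat.pair (Nat.pair 0 (encode r))
        (Nat.pair 0 (encode r))))) := by
  induction L with
  | nil => rfl
  | cons m L ih => rw [List.foldr_cons, ← ih]; rfl

theorem WFO.code_sentence (k : ℕ) (L : List (List α × ℕ × R)) (r : R) :
    (sentence k L r).code = Nat.pair 2 (Nat.pair
      (Nat.pair 5 (Nat.pair 0 (codeDisj (L.map fun m => (markFormula k m).code))))
      (Nat.pair (Nat.pair 1 (Nat.pair 0 (stepFormula k L r).code)) (Nat.pair 0 0))) := by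
  rw [sentence, WFO.code, condFormula, FO.code, FO.code_disj, List.map_map]
  rfl

theorem WFO.code_sentence_map (k : ℕ) (L : List (List α × ℕ × R)) (r : R) :
    (sentence k (L.map fun m => (m.1.map encode, m.2)) r).code = (sentence k L r).code := by
  have hm : ∀ m : List α × ℕ × R,
      (markFormula k (m.1.map encode, m.2)).code = (markFormula k m).code := fun m =>
    FO.code_hintikka_map m.1 k _
  simp only [WFO.code_sentence, StepWFO.code_stepFormula, List.map_map, List.foldr_map, hm,
    Function.comp_def]

end Codes
end WFOLogic

/-! ### Primitive recursiveness of the construction -/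

namespace WFOLogic

section Primrec

open Encodable

variable {β : Type*} [Primcodable β]

theorem primrec_pow : Primrec₂ ((· ^ ·) : ℕ → ℕ → ℕ) :=
  Primrec₂.unpaired'.1 Nat.Primrec.pow

/-- `gameRank` calls itself only with `K` letters, so its diagonal is a plain primitive recursion in
`n`; `roundBound` uses only diagonal values. -/
theorem primrec_gameRank_diag : Primrec₂ fun K n => PosWord.gameRank K n K :=
  (Primrec.nat_rec (f := fun _ : ℕ => 0) (g := fun K p => K * (p.2 + 2)) (Primrec.const 0)
    (Primrec.nat_mul.comp Primrec.fst
      (Primrec.nat_add.comp (Primrec.snd.comp Primrec.snd) (Primrec.const 2)))).of_eq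
    fun K n => by
      induction n with
      | zero => rfl
      | succ n ih => rw [PosWord.gameRank, ← ih]

theorem primrec_roundBound : Primrec WeightedAutomaton.roundBound := by
  have h : Primrec fun n : ℕ => 2 ^ n := primrec_pow.comp (Primrec.const 2) Primrec.id
  exact primrec_gameRank_diag.comp (primrec_pow.comp h h) h

theorem primrec_lengthBound : Primrec₂ PosWord.lengthBound := by
  have h2 : Primrec fun n : ℕ => 2 ^ n := primrec_pow.comp (Primrec.const 2) Primrec.id
  have hk : Primrec fun p : ℕ × ℕ => p.2 + 0 := Primrec.nat_add.comp Primrec.snd (Primrec.const 0)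
  have hbase : Primrec fun p : ℕ × ℕ => (p.1 + 1) ^ (p.2 + 0) * (2 ^ (p.2 + 0)) ^ (p.2 + 0) :=
    Primrec.nat_mul.comp (primrec_pow.comp (Primrec.succ.comp Primrec.fst) hk)
      (primrec_pow.comp (h2.comp hk) hk)
  have hcl : Primrec fun p : ℕ × ℕ => PosWord.numClasses (p.1 + 1) p.2 0 :=
    Primrec.nat_iterate Primrec.snd hbase (h2.comp Primrec.snd).to₂
  exact Primrec.nat_add.comp (Primrec.nat_mul.comp (Primrec.const 2) hcl) (Primrec.const 1)

theorem primrec_listsUpTo {τ : Type*} [Primcodable τ] :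
    Primrec₂ (listsUpTo : List τ → ℕ → List (List τ)) := by
  have hstep : Primrec₂ fun (T : List τ) (p : ℕ × List (List τ)) =>
      [] :: p.2.flatMap fun l => T.map fun t => t :: l := by
    have hcons : Primrec₂ fun (z : (List τ × ℕ × List (List τ)) × List τ) (t : τ) => t :: z.2 :=
      Primrec.list_cons.comp Primrec.snd (Primrec.snd.comp Primrec.fst)
    exact Primrec.list_cons.comp (Primrec.const []) (Primrec.list_flatMap
      (Primrec.snd.comp Primrec.snd) (Primrec.list_map (Primrec.fst.comp Primrec.fst) hcons).to₂)
  refine (Primrec.nat_rec (Primrec.const [[]]) hstep).of_eq fun T n => ?_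
  induction n with
  | zero => rfl
  | succ n ih => rw [listsUpTo, ← ih]

variable {R : Type w} [Primcodable R]

theorem primrec_runEnd :
    Primrec₂ (runEnd : ℕ → List (ℕ × ℕ × ℕ × R) → Option ℕ) := by
  have ht : Primrec fun z : (ℕ × List (ℕ × ℕ × ℕ × R)) × Option ℕ × ℕ × ℕ × ℕ × R => z.2.2 :=
    Primrec.snd.comp Primrec.snd
  have hstep : Primrec₂ fun (_ : ℕ × List (ℕ × ℕ × ℕ × R))
      (z : Option ℕ × ℕ × ℕ × ℕ × R) => if z.1 = some z.2.1 then some z.2.2.2.1 else none :=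
    Primrec.ite (PrimrecRel.comp Primrec.eq (Primrec.fst.comp Primrec.snd)
      (Primrec.option_some.comp (Primrec.fst.comp ht)))
      (Primrec.option_some.comp (Primrec.fst.comp (Primrec.snd.comp (Primrec.snd.comp ht))))
      (Primrec.const none)
  exact Primrec.list_foldl Primrec.snd (Primrec.option_some.comp Primrec.fst) hstep

theorem primrec_marks :
    Primrec (marks : List (ℕ × ℕ × ℕ × R) → List (List ℕ × ℕ × R)) := by
  have hw : Primrec fun l : List (ℕ × ℕ × ℕ × R) => l.map fun t => t.2.1 :=
    Primrec.list_map Primrec.id (Primrec.fst.comp (Primrec.snd.comp Primrec.snd)).to₂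
  have hmark : Primrec₂ fun (z : List (ℕ × ℕ × ℕ × R) × ℕ) (t : ℕ × ℕ × ℕ × R) =>
      (z.1.map fun t => t.2.1, z.2, t.2.2.2) :=
    Primrec.pair (hw.comp (Primrec.fst.comp Primrec.fst)) (Primrec.pair
      (Primrec.snd.comp Primrec.fst)
      (Primrec.snd.comp (Primrec.snd.comp (Primrec.snd.comp Primrec.snd))))
  exact Primrec.list_flatMap (Primrec.list_range.comp Primrec.list_length)
    (Primrec.optionToList.comp (Primrec.option_map
      (Primrec.list_getElem?.comp Primrec.fst Primrec.snd) hmark)).to₂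

theorem primrec_marking : Primrec fun x : (ℕ × ℕ) × ℕ × List (ℕ × ℕ × ℕ × R) =>
    marking x.1.1 x.1.2 x.2.1 x.2.2 := by
  have hbody : Primrec₂ fun (x : (ℕ × ℕ) × ℕ × List (ℕ × ℕ × ℕ × R))
      (l : List (ℕ × ℕ × ℕ × R)) => if runEnd x.1.1 l = some x.1.2 then marks l else [] :=
    Primrec.ite (PrimrecRel.comp Primrec.eq
      (primrec_runEnd.comp (Primrec.fst.comp (Primrec.fst.comp Primrec.fst)) Primrec.snd)
      (Primrec.option_some.comp (Primrec.snd.comp (Primrec.fst.comp Primrec.fst))))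
      (primrec_marks.comp Primrec.snd) (Primrec.const [])
  exact Primrec.list_flatMap
    (primrec_listsUpTo.comp (Primrec.snd.comp Primrec.snd) (Primrec.fst.comp Primrec.snd)) hbody

theorem primrec_pair_const (n : ℕ) {f : β → ℕ} (hf : Primrec f) :
    Primrec fun b => Nat.pair n (f b) :=
  Primrec₂.natPair.comp (Primrec.const n) hf

theorem primrec_codeConj : Primrec codeConj :=
  Primrec.list_foldr Primrec.id (Primrec.const _)
    (primrec_pair_const 4 (Primrec₂.natPair.comp (Primrec.fst.comp Primrec.snd)
      (Primrec.snd.comp Primrec.snd))).to₂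

theorem primrec_codeDisj : Primrec codeDisj :=
  primrec_pair_const 3 (primrec_codeConj.comp
    (Primrec.list_map Primrec.id (primrec_pair_const 3 Primrec.snd).to₂))

theorem primrec_codeEx : Primrec₂ codeEx :=
  primrec_pair_const 3 (primrec_pair_const 5 (Primrec₂.natPair.comp Primrec.fst
    (primrec_pair_const 3 Primrec.snd)))

theorem primrec_code_letterAtom :
    Primrec₂ fun (w : List ℕ) (x : ℕ × ℕ) => (FO.letterAtom w x).code := by
  have h : Primrec fun y : List ℕ × ℕ × ℕ => (Option.casesOn (y.1[y.2.2]?)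
      (Nat.pair 3 (Nat.pair 0 0)) (fun a => Nat.pair 1 (Nat.pair a y.2.1)) : ℕ) :=
    Primrec.option_casesOn
      (Primrec.list_getElem?.comp Primrec.fst (Primrec.snd.comp Primrec.snd)) (Primrec.const _)
      (primrec_pair_const 1 (Primrec₂.natPair.comp Primrec.snd
        (Primrec.fst.comp (Primrec.snd.comp Primrec.fst)))).to₂
  refine h.of_eq fun y => ?_
  simp only [FO.letterAtom]
  cases y.1[y.2.2]? <;> rfl

theorem primrec_code_atomicType :
    Primrec₂ fun (w : List ℕ) (p : List (ℕ × ℕ)) => (FO.atomicType w p).code := by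
  simp only [FO.code_atomicType]
  have hx : Primrec fun z : ((List ℕ × List (ℕ × ℕ)) × ℕ × ℕ) × ℕ × ℕ => z.1.2 :=
    Primrec.snd.comp Primrec.fst
  have hy : Primrec fun z : ((List ℕ × List (ℕ × ℕ)) × ℕ × ℕ) × ℕ × ℕ => z.2 := Primrec.snd
  have hle := primrec_pair_const 2 (Primrec₂.natPair.comp (Primrec.fst.comp hx)
    (Primrec.fst.comp hy))
  have horder : Primrec₂ fun (z : (List ℕ × List (ℕ × ℕ)) × ℕ × ℕ) (y : ℕ × ℕ) =>
      if z.2.2 ≤ y.2 then Nat.pair 2 (Nat.pair z.2.1 y.1) else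
        Nat.pair 3 (Nat.pair 2 (Nat.pair z.2.1 y.1)) :=
    Primrec.ite (PrimrecRel.comp Primrec.nat_le (Primrec.snd.comp hx) (Primrec.snd.comp hy)) hle
      (primrec_pair_const 3 hle)
  exact primrec_pair_const 4 (Primrec₂.natPair.comp
    (primrec_codeConj.comp (Primrec.list_map Primrec.snd (primrec_code_letterAtom.comp
      (Primrec.fst.comp Primrec.fst) Primrec.snd).to₂))
    (primrec_codeConj.comp (Primrec.list_flatMap Primrec.snd
      (Primrec.list_map (Primrec.snd.comp Primrec.fst) horder).to₂)))

/-- The pebble list changes in the recursive calls, so recursion on `k` with fixed parameters does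
not apply. Instead `l` lists the finitely many calls, each with one round fewer, and `g` combines
their values. -/
theorem primrec_code_hintikka : Primrec fun b : ℕ × List ℕ × List (ℕ × ℕ) =>
    (FO.hintikka b.2.1 b.1 b.2.2).code := by
  have hw : Primrec fun b : ℕ × List ℕ × List (ℕ × ℕ) => b.2.1 := Primrec.fst.comp Primrec.snd
  have hp : Primrec fun b : ℕ × List ℕ × List (ℕ × ℕ) => b.2.2 := Primrec.snd.comp Primrec.snd
  have hat := primrec_code_atomicType.comp hw hp
  refine Primrec.nat_omega_rec' _ (m := Prod.fst)
    (l := fun b => Nat.casesOn b.1 [] fun k =>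
      (List.range b.2.1.length).map fun i => (k, b.2.1, (b.2.2.length, i) :: b.2.2))
    (g := fun b l => some (Nat.casesOn b.1 (FO.atomicType b.2.1 b.2.2).code fun _ =>
      Nat.pair 4 (Nat.pair (FO.atomicType b.2.1 b.2.2).code
        (Nat.pair 4 (Nat.pair (codeConj (l.map (codeEx b.2.2.length)))
          (Nat.pair 5 (Nat.pair b.2.2.length (codeDisj l)))))))) Primrec.fst ?_ ?_ ?_ ?_
  · have hb : Primrec fun z : ((ℕ × List ℕ × List (ℕ × ℕ)) × ℕ) × ℕ => z.1.1 :=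
      Primrec.fst.comp Primrec.fst
    have hi : Primrec₂ fun (z : (ℕ × List ℕ × List (ℕ × ℕ)) × ℕ) (i : ℕ) =>
        (z.2, z.1.2.1, (z.1.2.2.length, i) :: z.1.2.2) :=
      Primrec.pair (Primrec.snd.comp Primrec.fst) (Primrec.pair (hw.comp hb)
        (Primrec.list_cons.comp (Primrec.pair (Primrec.list_length.comp (hp.comp hb)) Primrec.snd)
          (hp.comp hb)))
    exact Primrec.nat_casesOn Primrec.fst (Primrec.const []) (Primrec.list_map
      (Primrec.list_range.comp (Primrec.list_length.comp (hw.comp Primrec.fst))) hi).to₂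
  · have hb : Primrec fun z : ((ℕ × List ℕ × List (ℕ × ℕ)) × List ℕ) × ℕ => z.1.1 :=
      Primrec.fst.comp Primrec.fst
    have hl : Primrec fun z : ((ℕ × List ℕ × List (ℕ × ℕ)) × List ℕ) × ℕ => z.1.2 :=
      Primrec.snd.comp Primrec.fst
    have hn := Primrec.list_length.comp (hp.comp hb)
    refine Primrec.option_some.comp (Primrec.nat_casesOn (Primrec.fst.comp Primrec.fst)
      (hat.comp Primrec.fst) (primrec_pair_const 4 (Primrec₂.natPair.comp (hat.comp hb)
        (primrec_pair_const 4 (Primrec₂.natPair.comp (primrec_codeConj.comp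
          (Primrec.list_map hl (primrec_codeEx.comp (hn.comp Primrec.fst) Primrec.snd).to₂))
          (primrec_pair_const 5 (Primrec₂.natPair.comp hn (primrec_codeDisj.comp hl))))))).to₂)
  · rintro ⟨k, w, p⟩ b' hb'
    cases k with
    | zero => simp at hb'
    | succ k =>
      obtain ⟨i, -, rfl⟩ := List.mem_map.1 hb'
      exact Nat.lt_succ_self k
  · rintro ⟨k, w, p⟩
    cases k with
    | zero => rfl
    | succ k =>
      refine congrArg some (FO.code_hintikka_succ w k p ?_).symm
      rw [List.map_map]
      rfl

theorem primrec_code_markFormula : Primrec₂ fun (k : ℕ) (m : List ℕ × ℕ × R) =>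
    (markFormula k m).code :=
  primrec_code_hintikka.comp (Primrec.pair Primrec.fst (Primrec.pair
    (Primrec.fst.comp Primrec.snd) (Primrec.list_cons.comp (Primrec.pair (Primrec.const 0)
      (Primrec.fst.comp (Primrec.snd.comp Primrec.snd))) (Primrec.const []))))

theorem primrec_code_sentence (r : R) :
    Primrec₂ fun (k : ℕ) (L : List (List ℕ × ℕ × R)) => (sentence k L r).code := by
  simp only [WFO.code_sentence, StepWFO.code_stepFormula]
  have hm : Primrec fun z : (ℕ × List (List ℕ × ℕ × R)) × (List ℕ × ℕ × R) × ℕ => z.2.1 :=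
    Primrec.fst.comp Primrec.snd
  have hstep : Primrec₂ fun (z : ℕ × List (List ℕ × ℕ × R)) (m : (List ℕ × ℕ × R) × ℕ) =>
      Nat.pair 1 (Nat.pair (markFormula z.1 m.1).code
        (Nat.pair (Nat.pair 0 (encode m.1.2.2)) m.2)) :=
    primrec_pair_const 1 (Primrec₂.natPair.comp
      (primrec_code_markFormula.comp (Primrec.fst.comp Primrec.fst) hm) (Primrec₂.natPair.comp
        (primrec_pair_const 0 (Primrec.encode.comp (Primrec.snd.comp (Primrec.snd.comp hm))))
        (Primrec.snd.comp Primrec.snd)))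
  have hfold := Primrec.list_foldr (Primrec.snd (α := ℕ) (β := List (List ℕ × ℕ × R)))
    (Primrec.const (Nat.pair 1 (Nat.pair (Nat.pair 2 (Nat.pair 0 0))
      (Nat.pair (Nat.pair 0 (encode r)) (Nat.pair 0 (encode r)))))) hstep
  exact primrec_pair_const 2 (Primrec₂.natPair.comp (primrec_pair_const 5 (primrec_pair_const 0
    (primrec_codeDisj.comp (Primrec.list_map Primrec.snd (primrec_code_markFormula.comp
      (Primrec.fst.comp Primrec.fst) Primrec.snd).to₂))))
    (Primrec₂.natPair.comp (primrec_pair_const 1 (primrec_pair_const 0 hfold))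
      (Primrec.const _)))

/-- The code of the sentence of an automaton, from the number of states and letters, a listing of
the transitions, and two states. -/
def constructCode (r : R) (x : ℕ × ℕ × List (ℕ × ℕ × ℕ × R) × ℕ × ℕ) : ℕ :=
  (sentence (WeightedAutomaton.roundBound x.1) (marking x.2.2.2.1 x.2.2.2.2
    (PosWord.lengthBound x.2.1 (WeightedAutomaton.roundBound x.1)) x.2.2.1) r).code

theorem primrec_constructCode (r : R) : Primrec (constructCode r) := by
  have hk : Primrec fun x : ℕ × ℕ × List (ℕ × ℕ × ℕ × R) × ℕ × ℕ =>
      WeightedAutomaton.roundBound x.1 := primrec_roundBound.comp Primrec.fst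
  have hx : Primrec fun x : ℕ × ℕ × List (ℕ × ℕ × ℕ × R) × ℕ × ℕ => x.2.2 :=
    Primrec.snd.comp Primrec.snd
  exact (primrec_code_sentence r).comp hk (primrec_marking.comp
    (Primrec.pair (Primrec.snd.comp hx) (Primrec.pair
      (primrec_lengthBound.comp (Primrec.fst.comp Primrec.snd) hk) (Primrec.fst.comp hx))))

end Primrec

end WFOLogic

open WFOLogic in
/-- The first part is the existence of the sentence, over any finite alphabet `α` and any nonempty
set `R` of weights. The second part says that the sentence can be computed from the automaton:
if the weights are effectively presented, there is one partial recursive function that, given the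
numbers of states and letters, a listing of the weighted transitions and the two states, outputs
(the Gödel number of) such a sentence. -/
theorem theorem5p1 {R : Type w} [Nonempty R] :
    (∀ {Q : Type u} {α : Type v} [Finite Q] [Finite α] (A : WeightedAutomaton Q α R) (p q : Q),
      A.Aperiodic → A.UnambiguousFromTo p q →
      ∃ (φ : FO α) (x : ℕ) (Ψ : StepWFO α R) (Φ : WFO α R),
        Φ = WFO.ite φ (WFO.prod x Ψ) WFO.zero ∧
        φ.freeVars = ∅ ∧ Ψ.freeVars = {x} ∧ Φ.freeVars = ∅ ∧
        ∀ u : List α, u ≠ [] → ∀ σ : ℕ → Fin u.length,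
          A.absSem p q u = Φ.absSem u σ) ∧
    (∀ [Primcodable R],
      ∃ construct : ℕ × ℕ × List (ℕ × ℕ × ℕ × R) × ℕ × ℕ →. ℕ, Partrec construct ∧
        ∀ (n k : ℕ) (A : WeightedAutomaton (Fin n) (Fin k) R) (p q : Fin n)
          (T : List (ℕ × ℕ × ℕ × R)), A.ListedBy T →
          A.Aperiodic → A.UnambiguousFromTo p q →
          ∃ (φ : FO (Fin k)) (x : ℕ) (Ψ : StepWFO (Fin k) R) (Φ : WFO (Fin k) R),
            Φ = WFO.ite φ (WFO.prod x Ψ) WFO.zero ∧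
            φ.freeVars = ∅ ∧ Ψ.freeVars = {x} ∧ Φ.freeVars = ∅ ∧
            Φ.code ∈ construct (n, k, T, (p : ℕ), (q : ℕ)) ∧
            ∀ u : List (Fin k), u ≠ [] → ∀ σ : ℕ → Fin u.length,
              A.absSem p q u = Φ.absSem u σ) := by

  classical
  refine ⟨?_, ?_⟩
  · intro Q α _ _ A p q hA hU
    have := Fintype.ofFinite A.trans
    obtain ⟨r⟩ := ‹Nonempty R›
    have hL := A.isMarking_marking (T := (Finset.univ : Finset A.trans).toList.map A.tuple)
      (by simp) p q (PosWord.lengthBound (Nat.card α)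
        (WeightedAutomaton.roundBound (Nat.card Q)))
    exact ⟨condFormula _ _, 0, stepFormula _ _ r, _, rfl, freeVars_condFormula _ _,
      freeVars_stepFormula _ _ _, freeVars_sentence _ _ _,
      fun u hu σ => WeightedAutomaton.absSem_eq_sentence hA hU rfl hL r hu σ⟩
  · intro _
    obtain ⟨r⟩ := ‹Nonempty R›
    -- The function is total, with the default weight `r` built in as a constant; the hypotheses on
    -- the automaton are needed only for correctness of the output.
    refine ⟨fun x => Part.some (constructCode r x), (primrec_constructCode r).to_comp.partrec, ?_⟩
    intro n k A p q T hT hA hU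
    obtain ⟨T', rfl⟩ := exists_map_eq_of_forall_mem
      (f := mapTransition (R := R) (Fin.val : Fin n → ℕ) (Fin.val : Fin k → ℕ)) (l := T) (by
        rintro ⟨s, a, t, r⟩ ht
        obtain ⟨δ, rfl, rfl, rfl, rfl⟩ := (hT s a t r).1 ht
        exact ⟨A.tuple δ, rfl⟩)
    have hinj : Function.Injective
        (mapTransition (R := R) (Fin.val : Fin n → ℕ) (Fin.val : Fin k → ℕ)) := by
      rintro ⟨s, a, t, r⟩ ⟨s', a', t', r'⟩ h
      simpa [mapTransition, Fin.ext_iff] using h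
    have hT' : ∀ t, t ∈ T' ↔ ∃ δ, A.tuple δ = t := by
      intro t
      rw [← List.mem_map_of_injective hinj, mapTransition, hT]
      refine exists_congr fun δ => ?_
      rw [← hinj.eq_iff]
      simp [mapTransition, WeightedAutomaton.tuple]
    have hL := A.isMarking_marking hT' p q (PosWord.lengthBound (Nat.card (Fin k))
      (WeightedAutomaton.roundBound (Nat.card (Fin n))))
    refine ⟨condFormula _ _, 0, stepFormula _ _ r, _, rfl, freeVars_condFormula _ _,
      freeVars_stepFormula _ _ _, freeVars_sentence _ _ _, ?_,
      fun u hu σ => WeightedAutomaton.absSem_eq_sentence hA hU rfl hL r hu σ⟩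
    -- The code of a letter in `Fin k` is its value, so the sentence over numbered letters and the
    -- sentence over `Fin k` have the same code.
    rw [Part.mem_some_iff, constructCode, marking_map Fin.val_injective, Nat.card_fin,
      Nat.card_fin]
    exact (WFO.code_sentence_map _ _ r).symm
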